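/- All manifolds are smooth, Hausdorff and without boundary, and all objects are smooth. A statistical structure on a manifold is a pair $(g,\nabla)$ of a Riemannian metric and a torsion-free affine connection with $(\nabla_X g)(Y,Z)=(\nabla_Y g)(X,Z)$ for all $X,Y,Z$. Write $\nabla^g$ for the Levi-Civita connection, $\overline\nabla$ for the conjugate connection, $Xg(Y,Z)=g(\nabla_XY,Z)+g(Y,\overline\nabla_XZ)$, and $K(X,Y)=\nabla_XY-\nabla^g_XY$; the structure is trace-free if $\operatorname{tr}_gK=0$. Let $R(X,Y)Z=\nabla_X\nabla_YZ-\nabla_Y\nabla_XZ-\nabla_{[X,Y]}Z$, let $\operatorname{Ric}(Y,Z)=\operatorname{tr}(X\mapsto R(X,Y)Z)$, let $\overline{\operatorname{Ric}}$ and $\operatorname{Ric}^g$ be the Ricci tensors of $\overline\nabla$ and $\nabla^g$ (defined in the same way), and define $L$ by $g(L(Z,W)X,Y)=g(R(X,Y)Z,W)$. For a map $u:(M,g,\nabla^M)\to(N,h,\nabla^N)$ of statistical manifolds, let $\nabla^u,\overline\nabla^u$ be the connections on $u^{-1}TN$ induced from $\nabla^N,\overline\nabla^N$. Put $\tau(u)=\operatorname{tr}_g\{(X,Y)\mapsto\nabla^u_Xu_*Y-u_*\nabla^M_XY\}$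 and, for a local $g$-orthonormal frame $(e_i)$, $$\tau_2(u)=\bar\Delta^u\tau(u)+\operatorname{div}^g(\operatorname{tr}_gK^M)\,\tau(u)-\sum_iL^N(u_*e_i,\tau(u))u_*e_i-K^N(\tau(u),\tau(u)),$$ where $\bar\Delta^u\xi=\operatorname{tr}_g\{(X,Y)\mapsto\overline\nabla^u_X\overline\nabla^u_Y\xi-\overline\nabla^u_{\overline\nabla^M_XY}\xi\}$ and $\operatorname{div}^gX=\operatorname{tr}\nabla^gX$. The map $u$ is (statistical) biharmonic if $\tau_2(u)=0$. **Proposition.** Let $(M,g,\nabla^M)$ and $(N,h,\nabla^N)$ be statistical manifolds with $\dim N=\dim M+1$, and let $u:M\to N$ be a statistical hypersurface, that is, $(g,\nabla^M)$ is induced by $u$: $g(X,Y)=h(u_*X,u_*Y)$ and $g(\nabla^M_XY,Z)=h(\nabla^u_Xu_*Y,u_*Z)$ for all vector fields $X,Y,Z$ on $M$. Suppose that $(N,h,\nabla^N)$ is trace-free and that $$\operatorname{Ric}^N(v,v)-\overline{\operatorname{Ric}}^N(v,v)-2\operatorname{Ric}^h(v,v)\ge 0\quad\text{for every tangent vector }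 v \text{ of } N.$$ If $u$ is biharmonic, $K^N(\tau(u),\tau(u))=0$ on $M$, and $\|\tau(u)\|_h$ is constant on $M$, then $\tau(u)=0$. -/

import Mathlib

open Bundle Manifold ContDiff

noncomputable section

namespace StatGeom

/-! ## Affine connections and Riemannian metrics -/

section Structures

variable {E : Type*} [NormedAddCommGroup E] [NormedSpace ℝ E] [FiniteDimensional ℝ E]
  {H : Type*} [TopologicalSpace H] {I : ModelWithCorners ℝ E H}
  {M : Type*} [TopologicalSpace M] [ChartedSpace H M] [IsManifold I ∞ M]

variable (I M) in
/-- Affine connections on `M`: covariant derivatives on the tangent bundle. For `D` such a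
connection, `D Y x v` stands for `∇_v Y` at the point `x`. -/
abbrev AffineConnection : Type _ := CovariantDerivative I E (fun x : M => TangentSpace I x)

variable (I M) in
/-- Smooth Riemannian metrics on `M`; `g.inner x v w` stands for `g(v, w)` at the point `x`. -/
abbrev Metric : Type _ := ContMDiffRiemannianMetric I ∞ E (fun x : M => TangentSpace I x)

/-- The map `(Y, Z) ↦ (v ↦ v g(Y, Z) - g(∇_v Y, Z) - g(Y, ∇_v Z))` at the point `x`. -/
def nablaMetricAux (g : Metric I M) (D : AffineConnection I M) (x : M)
    (Y Z : Π x : M, TangentSpace I x) : TangentSpace I x →L[ℝ] ℝ :=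
  mvfderiv I (fun y => g.inner y (Y y) (Z y)) x
    - g.inner x (Z x) ∘L D Y x - g.inner x (Y x) ∘L D Z x

theorem mdifferentiableAt_inner (g : Metric I M) {x : M} {Y Z : Π x : M, TangentSpace I x}
    (hY : MDiffAt (T% Y) x) (hZ : MDiffAt (T% Z) x) :
    MDiffAt (fun y => g.inner y (Y y) (Z y)) x := by
  have : MDifferentiableAt I (I.prod 𝓘(ℝ))
      (fun m ↦ TotalSpace.mk' ℝ (E := Bundle.Trivial M ℝ) m (g.inner m (Y m) (Z m))) x :=
    MDifferentiableAt.clm_bundle_apply₂ (F₁ := E) (F₂ := E)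
      (g.contMDiff.mdifferentiableAt (by simp)) hY hZ
  simp only [mdifferentiableAt_totalSpace] at this
  exact this.2

theorem tensorial_nablaMetricAux_left (g : Metric I M) (D : AffineConnection I M) (x : M)
    (Z : Π x : M, TangentSpace I x) (hZ : MDiffAt (T% Z) x) :
    TensorialAt I E (nablaMetricAux g D x · Z) x where
  smul hf hY := by
    ext v
    simp [nablaMetricAux, mvfderiv_fun_mul hf (mdifferentiableAt_inner g hY hZ),
      D.isCovariantDerivativeOn.leibniz hY hf, g.symm x (Z x)]
    ring
  add hY hY' := by
    ext v
    simp [nablaMetricAux, mvfderiv_fun_add (mdifferentiableAt_inner g hY hZ)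
      (mdifferentiableAt_inner g hY' hZ), D.isCovariantDerivativeOn.add hY hY', g.symm x (Z x)]
    ring

theorem tensorial_nablaMetricAux_right (g : Metric I M) (D : AffineConnection I M) (x : M)
    (Y : Π x : M, TangentSpace I x) (hY : MDiffAt (T% Y) x) :
    TensorialAt I E (nablaMetricAux g D x Y ·) x where
  smul hf hZ := by
    ext v
    simp [nablaMetricAux, mvfderiv_fun_mul hf (mdifferentiableAt_inner g hY hZ),
      D.isCovariantDerivativeOn.leibniz hZ hf, g.symm x _ (D Y x v)]
    ring
  add hZ hZ' := by
    ext v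
    simp [nablaMetricAux, mvfderiv_fun_add (mdifferentiableAt_inner g hY hZ)
      (mdifferentiableAt_inner g hY hZ'), D.isCovariantDerivativeOn.add hZ hZ', g.symm x _ (D Y x v)]
    ring

/-- The tensor `∇g`: `nablaMetric g D x y z v = (∇_v g)(y, z)`, where
`(∇_X g)(Y, Z) = X g(Y, Z) - g(∇_X Y, Z) - g(Y, ∇_X Z)`. -/
def nablaMetric (g : Metric I M) (D : AffineConnection I M) (x : M) :
    TangentSpace I x →L[ℝ] TangentSpace I x →L[ℝ] TangentSpace I x →L[ℝ] ℝ :=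
  TensorialAt.mkHom₂ (nablaMetricAux g D x) x
    (tensorial_nablaMetricAux_left g D x) (tensorial_nablaMetricAux_right g D x)

theorem nablaMetric_apply (g : Metric I M) (D : AffineConnection I M) {x : M}
    {Y Z : Π x : M, TangentSpace I x} (hY : MDiffAt (T% Y) x) (hZ : MDiffAt (T% Z) x)
    (v : TangentSpace I x) :
    nablaMetric g D x (Y x) (Z x) v = mvfderiv I (fun y => g.inner y (Y y) (Z y)) x v
      - g.inner x (D Y x v) (Z x) - g.inner x (Y x) (D Z x v) := by
  rw [nablaMetric, TensorialAt.mkHom₂_apply _ _ hY hZ, g.symm x _ (Z x)]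
  rfl

theorem exists_orthonormalFrame (g : Metric I M) (x : M) :
    ∃ b : Module.Basis (Fin (Module.finrank ℝ E)) ℝ (TangentSpace I x),
      ∀ i j, g.inner x (b i) (b j) = if i = j then 1 else 0 := by
  have : FiniteDimensional ℝ (TangentSpace I x) := inferInstanceAs (FiniteDimensional ℝ E)
  letI c := g.toRiemannianMetric.toCore x
  letI := c.toNormedAddCommGroup
  letI : InnerProductSpace ℝ (TangentSpace I x) := InnerProductSpace.ofCore c.toCore
  let b := (stdOrthonormalBasis ℝ (TangentSpace I x)).reindex
    (finCongr (show Module.finrank ℝ (TangentSpace I x) = Module.finrank ℝ E from rfl))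
  refine ⟨b.toBasis, fun i j => ?_⟩
  have := orthonormal_iff_ite.1 b.orthonormal i j
  rw [b.coe_toBasis]
  exact this

/-- An orthonormal basis `e_1, …, e_m` of the tangent space at `x`. -/
def frame (g : Metric I M) (x : M) :
    Module.Basis (Fin (Module.finrank ℝ E)) ℝ (TangentSpace I x) :=
  (exists_orthonormalFrame g x).choose

theorem inner_frame (g : Metric I M) (x : M) (i j : Fin (Module.finrank ℝ E)) :
    g.inner x (frame g x i) (frame g x j) = if i = j then 1 else 0 :=
  (exists_orthonormalFrame g x).choose_spec i j

/-- The trace `tr_g B = ∑ B(e_i, e_i)` of a bilinear map `B` on the tangent space at `x`. -/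
def metricTrace (g : Metric I M) {W : Type*} [AddCommGroup W] (x : M)
    (B : TangentSpace I x → TangentSpace I x → W) : W :=
  ∑ i, B (frame g x i) (frame g x i)

/-- For `φ` linear, the vector `w` in the tangent space at `x` with `g(w, z) = φ z` for all `z`. -/
def sharp (g : Metric I M) (x : M) (φ : TangentSpace I x → ℝ) : TangentSpace I x :=
  ∑ i, φ (frame g x i) • frame g x i

theorem inner_sharp (g : Metric I M) (x : M) (φ : TangentSpace I x →ₗ[ℝ] ℝ)
    (z : TangentSpace I x) : g.inner x (sharp g x φ) z = φ z := by
  have h : (g.inner x (sharp g x φ)).toLinearMap = φ := by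
    refine (frame g x).ext fun j => ?_
    simp [sharp, inner_frame]
  exact LinearMap.congr_fun h z

/-- The tensor `A` with `g(A(y, v), z) = (∇_v g)(y, z)`. -/
def conjugateForm (g : Metric I M) (D : AffineConnection I M) (x : M) :
    TangentSpace I x →L[ℝ] TangentSpace I x →L[ℝ] TangentSpace I x :=
  have : FiniteDimensional ℝ (TangentSpace I x) := inferInstanceAs (FiniteDimensional ℝ E)
  have : T2Space (TangentSpace I x) := inferInstanceAs (T2Space E)
  (LinearMap.mk₂ ℝ (fun y v : TangentSpace I x => sharp g x fun z => nablaMetric g D x y z v)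
    (fun _ _ _ => by simp [sharp, add_smul, Finset.sum_add_distrib])
    (fun _ _ _ => by simp [sharp, Finset.smul_sum, smul_smul])
    (fun _ _ _ => by simp [sharp, add_smul, Finset.sum_add_distrib])
    (fun _ _ _ => by simp [sharp, Finset.smul_sum, smul_smul])).toContinuousBilinearMap

/-- The conjugate connection `∇̄` of `∇` with respect to `g`, characterized by
`X g(Y, Z) = g(∇_X Y, Z) + g(Y, ∇̄_X Z)`, see `conjugate_spec`. -/
def conjugate (g : Metric I M) (D : AffineConnection I M) : AffineConnection I M :=
  D.addOneForm (conjugateForm g D)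

theorem inner_conjugateForm (g : Metric I M) (D : AffineConnection I M) (x : M)
    (y v z : TangentSpace I x) :
    g.inner x (conjugateForm g D x y v) z = nablaMetric g D x y z v := by
  let φ : TangentSpace I x →ₗ[ℝ] ℝ :=
    { toFun := fun z => nablaMetric g D x y z v
      map_add' := by simp
      map_smul' := by simp }
  exact inner_sharp g x φ z

theorem nablaMetric_symm (g : Metric I M) (D : AffineConnection I M) (x : M)
    (y z v : TangentSpace I x) : nablaMetric g D x y z v = nablaMetric g D x z y v := by
  have hy := FiberBundle.mdifferentiableAt_extend I E y
  have hz := FiberBundle.mdifferentiableAt_extend I E z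
  have h1 := nablaMetric_apply g D hy hz v
  have h2 := nablaMetric_apply g D hz hy v
  simp only [FiberBundle.extend_apply_self] at h1 h2
  have h3 : (fun p => g.inner p (FiberBundle.extend E y p) (FiberBundle.extend E z p))
      = fun p => g.inner p (FiberBundle.extend E z p) (FiberBundle.extend E y p) :=
    funext fun p => g.symm p _ _
  rw [h1, h2, h3, g.symm x y, g.symm x z]
  ring

theorem conjugate_spec (g : Metric I M) (D : AffineConnection I M) {x : M}
    {Y Z : Π x : M, TangentSpace I x} (hY : MDiffAt (T% Y) x) (hZ : MDiffAt (T% Z) x)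
    (v : TangentSpace I x) :
    mvfderiv I (fun y => g.inner y (Y y) (Z y)) x v
      = g.inner x (D Y x v) (Z x) + g.inner x (Y x) (conjugate g D Z x v) := by
  have h1 := nablaMetric_apply g D hY hZ v
  have h2 := inner_conjugateForm g D x (Z x) v (Y x)
  have h3 : conjugate g D Z x v = D Z x v + conjugateForm g D x (Z x) v := rfl
  rw [h3, map_add, g.symm x (Y x) (conjugateForm g D x (Z x) v), h2, nablaMetric_symm, h1]
  ring

/-- `D` is the Levi-Civita connection of `g`: it is torsion-free and `∇g = 0`. -/
def IsLeviCivita (g : Metric I M) (D : AffineConnection I M) : Prop :=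
  D.torsion = 0 ∧ ∀ x, nablaMetric g D x = 0

variable (I M) in
/-- A statistical structure `(g, ∇)` on `M`: a Riemannian metric and a torsion-free affine
connection with `(∇_X g)(Y, Z) = (∇_Y g)(X, Z)`. -/
structure StatisticalStructure where
  metric : Metric I M
  nabla : AffineConnection I M
  smooth : nabla.ContMDiffCovariantDerivative ∞
  torsion_free : nabla.torsion = 0
  codazzi : ∀ (x : M) (v y z : TangentSpace I x),
    nablaMetric metric nabla x y z v = nablaMetric metric nabla x v z y

namespace StatisticalStructure

variable (S : StatisticalStructure I M)

theorem exists_leviCivita : ∃ D : AffineConnection I M, IsLeviCivita S.metric D := by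
  refine ⟨S.nabla.addOneForm (fun x => (1 / 2 : ℝ) • conjugateForm S.metric S.nabla x), ?_, ?_⟩
  · have hA (x : M) (v w : TangentSpace I x) : conjugateForm S.metric S.nabla x v w
        = conjugateForm S.metric S.nabla x w v := by
      by_contra hne
      have h := S.metric.pos x _ (sub_ne_zero.2 hne)
      have h2 (z) : S.metric.inner x (conjugateForm S.metric S.nabla x v w
          - conjugateForm S.metric S.nabla x w v) z = 0 := by
        rw [map_sub, sub_apply, inner_conjugateForm, inner_conjugateForm,
          S.codazzi, sub_self]
      rw [h2] at h
      exact lt_irrefl _ h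
    have h0 := S.torsion_free
    rw [CovariantDerivative.torsion_eq_zero_iff] at h0 ⊢
    intro X Y x hX hY
    rw [← h0 hX hY]
    simp [CovariantDerivative.addOneForm, hA x (X x)]
  · intro x
    ext y z v
    have hy := FiberBundle.mdifferentiableAt_extend I E y
    have hz := FiberBundle.mdifferentiableAt_extend I E z
    have h1 := nablaMetric_apply S.metric S.nabla hy hz v
    have h2 := nablaMetric_apply S.metric (S.nabla.addOneForm
      (fun x => (1 / 2 : ℝ) • conjugateForm S.metric S.nabla x)) hy hz v
    simp only [FiberBundle.extend_apply_self] at h1 h2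
    rw [h2]
    have h3 := inner_conjugateForm S.metric S.nabla x z v y
    have h4 := inner_conjugateForm S.metric S.nabla x y v z
    rw [nablaMetric_symm, S.metric.symm] at h3
    simp [CovariantDerivative.addOneForm, h3, h4]
    linarith

/-- The Levi-Civita connection `∇^g`. -/
def leviCivita : AffineConnection I M := S.exists_leviCivita.choose

/-- The conjugate connection `∇̄`. -/
def nablaBar : AffineConnection I M := conjugate S.metric S.nabla

/-- The tensor `K(v, w) = ∇_v w - ∇^g_v w`. -/
def K (x : M) (v w : TangentSpace I x) : TangentSpace I x :=
  S.nabla.difference S.leviCivita x w v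

/-- The vector field `tr_g K`. -/
def traceK (x : M) : TangentSpace I x := metricTrace S.metric x (S.K x)

/-- The structure is trace-free: `tr_g K = 0`. -/
def TraceFree : Prop := ∀ x, S.traceK x = 0

end StatisticalStructure

/-- The curvature `R(v, w)z` of a connection at `x`, where
`R(X, Y)Z = ∇_X ∇_Y Z - ∇_Y ∇_X Z - ∇_[X, Y] Z`; the vectors are extended to local vector fields. -/
def curvature (D : AffineConnection I M) (x : M) (v w z : TangentSpace I x) : TangentSpace I x :=
  let X := FiberBundle.extend E v
  let Y := FiberBundle.extend E w
  let Z := FiberBundle.extend E z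
  D (fun p => D Z p (Y p)) x (X x) - D (fun p => D Z p (X p)) x (Y x)
    - D Z x (VectorField.mlieBracket I X Y x)

/-- The Ricci tensor `Ric(w, z) = tr (v ↦ R(v, w)z)` of a connection; `g` only serves to compute
the trace. -/
def ricci (g : Metric I M) (D : AffineConnection I M) (x : M) (w z : TangentSpace I x) : ℝ :=
  metricTrace g x fun v v' => g.inner x (curvature D x v w z) v'

/-- The divergence `div X = tr (v ↦ ∇_v X)`. -/
def divergence (D : AffineConnection I M) (X : Π x : M, TangentSpace I x) (x : M) : ℝ :=
  LinearMap.trace ℝ (TangentSpace I x) (D X x)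

/-- The curvature interchange tensor `L`, defined by `g(L(z, w)x, y) = g(R(x, y)z, w)`. -/
def StatisticalStructure.L (S : StatisticalStructure I M) (p : M) (z w x : TangentSpace I p) :
    TangentSpace I p :=
  sharp S.metric p fun y => S.metric.inner p (curvature S.nabla p x y z) w

end Structures

/-! ## Maps between statistical manifolds -/

section Maps

variable {E : Type*} [NormedAddCommGroup E] [NormedSpace ℝ E] [FiniteDimensional ℝ E]
  {H : Type*} [TopologicalSpace H] {I : ModelWithCorners ℝ E H}
  {M : Type*} [TopologicalSpace M] [ChartedSpace H M] [IsManifold I ∞ M]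
  {F : Type*} [NormedAddCommGroup F] [NormedSpace ℝ F] [FiniteDimensional ℝ F]
  {G : Type*} [TopologicalSpace G] {J : ModelWithCorners ℝ F G}
  {N : Type*} [TopologicalSpace N] [ChartedSpace G N] [IsManifold J ∞ N]

/-- The connection `∇^u` induced by `u : M → N` from a connection on `N`, on the sections `σ` of
`u⁻¹TN`: `pullback D u σ x v = (∇^u_v σ)(x)`. If `σ = ∑ σ^k (s_k ∘ u)` near `x` for the local frame
`(s_k)` of `TN` around `u x` given by the bundle chart, then it is
`∑ dσ^k(v) s_k + ∑ σ^k(x) ∇_{u_* v} s_k` at `x`; here `∑ σ^k(x) s_k` is the extension of `σ x` to a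
local vector field on `N` with constant coefficients. -/
def pullback (D : AffineConnection J N) (u : M → N) (σ : Π x : M, TangentSpace J (u x)) (x : M) :
    TangentSpace I x →L[ℝ] TangentSpace J (u x) :=
  let e := trivializationAt F (fun y : N => TangentSpace J y) (u x)
  e.symmL ℝ (u x) ∘L mvfderiv I (fun y => (e ⟨u y, σ y⟩).2) x
    + D (FiberBundle.extend F (σ x)) (u x) ∘L mfderiv I J u x

variable (I J) in
/-- The section `u_* X` of `u⁻¹TN`. -/
def pushforward (u : M → N) (X : Π x : M, TangentSpace I x) (x : M) : TangentSpace J (u x) :=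
  mfderiv I J u x (X x)

/-- The tension field `τ(u) = tr_g ((X, Y) ↦ ∇^u_X u_* Y - u_* ∇_X Y)`. -/
def tension (g : Metric I M) (DM : AffineConnection I M) (DN : AffineConnection J N) (u : M → N)
    (x : M) : TangentSpace J (u x) :=
  metricTrace g x fun v w =>
    pullback DN u (pushforward I J u (FiberBundle.extend E w)) x v
      - mfderiv I J u x (DM (FiberBundle.extend E w) x v)

/-- The statistical connection Laplacian
`Δξ = tr_g ((X, Y) ↦ ∇^u_X ∇^u_Y ξ - ∇^u_{∇_X Y} ξ)` on sections of `u⁻¹TN`. -/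
def laplacian (g : Metric I M) (DM : AffineConnection I M) (DN : AffineConnection J N) (u : M → N)
    (ξ : Π x : M, TangentSpace J (u x)) (x : M) : TangentSpace J (u x) :=
  metricTrace g x fun v w =>
    pullback DN u (fun y => pullback (I := I) DN u ξ y (FiberBundle.extend E w y)) x v
      - pullback DN u ξ x (DM (FiberBundle.extend E w) x v)

namespace StatisticalStructure

variable (S : StatisticalStructure I M) (T : StatisticalStructure J N) (u : M → N)

/-- The tension field of a map between statistical manifolds. -/
abbrev tau (x : M) : TangentSpace J (u x) := tension S.metric S.nabla T.nabla u x

/-- The statistical bi-tension field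
`τ₂(u) = Δ̄^u τ(u) + div^g(tr_g K^M) τ(u) - ∑ L^N(u_* e_i, τ(u)) u_* e_i - K^N(τ(u), τ(u))`. -/
def bitension (x : M) : TangentSpace J (u x) :=
  laplacian S.metric S.nablaBar T.nablaBar u (S.tau T u) x
    + divergence S.leviCivita S.traceK x • S.tau T u x
    - metricTrace S.metric x (fun v w =>
        T.L (u x) (mfderiv I J u x v) (S.tau T u x) (mfderiv I J u x w))
    - T.K (u x) (S.tau T u x) (S.tau T u x)

/-- `u` is a statistical biharmonic map. -/
def IsBiharmonic : Prop := ∀ x, S.bitension T u x = 0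

/-- The statistical structure `(g, ∇^M)` is the one induced by the smooth map `u` from
`(h, ∇^N)`: `g(X, Y) = h(u_* X, u_* Y)` and `g(∇^M_X Y, Z) = h(∇^N_X u_* Y, u_* Z)`. -/
structure IsInducedBy : Prop where
  contMDiff : ContMDiff I J ∞ u
  metric_eq : ∀ (x : M) (v w : TangentSpace I x),
    S.metric.inner x v w = T.metric.inner (u x) (mfderiv I J u x v) (mfderiv I J u x w)
  nabla_eq : ∀ (Y : Π x : M, TangentSpace I x) (x : M), MDiffAt (T% Y) x →
    ∀ v z : TangentSpace I x, S.metric.inner x (S.nabla Y x v) z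
      = T.metric.inner (u x) (pullback T.nabla u (pushforward I J u Y) x v) (mfderiv I J u x z)

end StatisticalStructure

end Maps

end StatGeom

end

open StatGeom

/-! Write `h` for the metric of `N`, `τ` for the tension field, `e_i` for an orthonormal basis of a
tangent space of `M` (and its image under `u_*`), and suppose `|τ|² = c > 0`. Since the structure on
`M` is induced, `τ` is normal; as the codimension is one, a multiple `ν` of `τ` completes the `u_*
e_i` to an orthonormal basis. Then `K(ν, ν) = 0`, so trace-freeness of `N` passes to `M`, and only
the Laplacian and the `L` term of `τ₂(u)` survive.

Pair `τ₂(u) = 0` with `τ`. Constancy of `|τ|` and `K(τ, τ) = 0` give `h(∇̄_v τ, τ) = 0`.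
Differentiating once more turns the Laplacian term into `-∑ h(∇̄_{e_i} τ, ∇_{e_i} τ) = -∑ |∇^h_{e_i}
τ|² + ∑ |K(τ, e_i)|²` (`inner_laplacian_self`, with `∇ = ∇^h + K` and `∇̄ = ∇^h - K`). Duality of
the curvatures of `∇` and `∇̄` (`inner_curvature_nabla`) makes the `L` sum equal to `-Ric̄(τ, τ)`.
Hence `∑ |∇^h_{e_i} τ|² = ∑ |K(τ, e_i)|² + Ric̄(τ, τ)`.

Tracing `R + R̄ = 2 (R^h + [K, K])` gives `Ric + Ric̄ = 2 (Ric^h - ∑ |K(τ, e_i)|²)` at `(τ, τ)`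
(`ricci_add_ricci_nablaBar`). Eliminating the `K` sum, `∑ |∇^h_{e_i} τ|² = -(Ric - Ric̄ - 2
Ric^h)(τ, τ) / 2 ≤ 0`, so `τ` is parallel along `u` for the Levi-Civita connection. Differentiating
`h(τ, u_* e_i) = 0` then yields `|τ|² = h(τ, ∑ K(u_* e_i, u_* e_i))` (`inner_tau_self_eq`). As `K(ν,
ν) = 0`, this sum is the full trace of `K`, which is zero: a contradiction.

Much of the rest justifies differentiating: `τ` and its derivatives must be shown smooth although
orthonormal bases are chosen pointwise. -/

set_option linter.unusedSectionVars false

noncomputable section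

/-! ### Calculus of `mvfderiv` -/

section Deriv

variable {E : Type*} [NormedAddCommGroup E] [NormedSpace ℝ E]
  {H : Type*} [TopologicalSpace H] {I : ModelWithCorners ℝ E H}
  {M : Type*} [TopologicalSpace M] [ChartedSpace H M]
  {E' : Type*} [NormedAddCommGroup E'] [NormedSpace ℝ E']
  {H' : Type*} [TopologicalSpace H'] {I' : ModelWithCorners ℝ E' H'}
  {N : Type*} [TopologicalSpace N] [ChartedSpace H' N]
  {F : Type*} [NormedAddCommGroup F] [NormedSpace ℝ F]
  {G : Type*} [NormedAddCommGroup G] [NormedSpace ℝ G]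

theorem mvfderiv_comp_map {g : N → F} {u : M → N} {x : M} (hg : MDiffAt g (u x))
    (hu : MDiffAt u x) :
    mvfderiv I (fun y => g (u y)) x = mvfderiv I' g (u x) ∘L mfderiv I I' u x := by
  ext v
  exact congrArg (fun T => T v) (mfderiv_comp x hg hu)

theorem Filter.EventuallyEq.mvfderiv_eq {f g : M → F} {x : M} (h : f =ᶠ[nhds x] g) :
    mvfderiv I f x = mvfderiv I g x := by
  ext v
  have h' := Filter.EventuallyEq.mfderiv_eq (I := I) (I' := 𝓘(ℝ, F)) h
  exact congrArg (fun T : TangentSpace I x →L[ℝ] F => T v) h'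

theorem mvfderiv_fun_sum {ι : Type*} (s : Finset ι) {f : ι → M → F} {x : M}
    (hf : ∀ i ∈ s, MDiffAt (f i) x) :
    mvfderiv I (fun y => ∑ i ∈ s, f i y) x = ∑ i ∈ s, mvfderiv I (f i) x := by
  classical
  induction s using Finset.induction_on with
  | empty => simpa using mvfderiv_const (I := I) (x := x) (0 : F)
  | insert a s ha ih =>
    simp only [Finset.mem_insert, forall_eq_or_imp] at hf
    have hs : MDiffAt (fun y => ∑ i ∈ s, f i y) x := by
      have h := hf.2
      clear ih ha hf
      induction s using Finset.induction_on with
      | empty => simpa using mdifferentiableAt_const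
      | insert b s hb ih =>
        simp only [Finset.mem_insert, forall_eq_or_imp] at h
        simp only [Finset.sum_insert hb]
        exact h.1.add (ih h.2)
    simp only [Finset.sum_insert ha]
    rw [mvfderiv_fun_add hf.1 hs, ih hf.2]

end Deriv

/-! ### Local frames from trivializations, and fields along a map -/

section Frames

variable {E : Type*} [NormedAddCommGroup E] [NormedSpace ℝ E]
  {H : Type*} [TopologicalSpace H] {I : ModelWithCorners ℝ E H}
  {M : Type*} [TopologicalSpace M] [ChartedSpace H M]
  {F : Type*} [NormedAddCommGroup F] [NormedSpace ℝ F] [FiniteDimensional ℝ F]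
  {G : Type*} [TopologicalSpace G] {J : ModelWithCorners ℝ F G}
  {N : Type*} [TopologicalSpace N] [ChartedSpace G N] [IsManifold J ∞ N]

variable (e : Trivialization F (TotalSpace.proj : TotalSpace F (TangentSpace J : N → Type _) → N))
  [MemTrivializationAtlas e]

/-- The local vector field with constant coefficients `a` in the trivialization `e`. -/
def constField (a : F) (y : N) : TangentSpace J y := e.symmL ℝ y a

/-- The `k`-th coefficient of the tangent vector `v` in the trivialization `e`. -/
def frameCoeff (k : Fin (Module.finrank ℝ F)) (y : N) (v : TangentSpace J y) : ℝ :=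
  (Module.finBasis ℝ F).coord k (e ⟨y, v⟩).2

/-- The `k`-th vector field of the local frame given by the trivialization `e`. -/
def frameField (k : Fin (Module.finrank ℝ F)) : Π y : N, TangentSpace J y :=
  constField e (Module.finBasis ℝ F k)

variable {e}

theorem snd_constField {y : N} (hy : y ∈ e.baseSet) (a : F) : (e ⟨y, constField e a y⟩).2 = a := by
  rw [constField, e.symmL_apply hy, e.mk_symm hy, e.apply_symm_apply' hy]

theorem constField_snd {y : N} (hy : y ∈ e.baseSet) (v : TangentSpace J y) :
    constField e (e ⟨y, v⟩).2 y = v := by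
  rw [constField, e.symmL_apply hy, e.symm_apply_apply_mk hy]

theorem eventuallyEq_extend (y : N) (v : TangentSpace J y) :
    ∀ᶠ z in nhds y, FiberBundle.extend F v z
      = constField (trivializationAt F (TangentSpace J) y)
        (trivializationAt F (TangentSpace J) y ⟨y, v⟩).2 z := by
  filter_upwards [(trivializationAt F (TangentSpace J) y).open_baseSet.mem_nhds
    (FiberBundle.mem_baseSet_trivializationAt' y)] with z hz
  exact (Trivialization.symmL_apply (R := ℝ) _ hz _).symm

theorem sum_frameCoeff {y : N} (hy : y ∈ e.baseSet) (v : TangentSpace J y) :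
    ∑ k, frameCoeff e k y v • frameField e k y = v := by
  conv_rhs => rw [← constField_snd hy v, ← (Module.finBasis ℝ F).sum_repr (e ⟨y, v⟩).2]
  simp only [constField, frameCoeff, frameField, map_sum, map_smul, Module.Basis.coord_apply]

theorem frameCoeff_add {y : N} (hy : y ∈ e.baseSet) (k) (v w : TangentSpace J y) :
    frameCoeff e k y (v + w) = frameCoeff e k y v + frameCoeff e k y w := by
  simp [frameCoeff, (e.linear ℝ hy).map_add]

theorem frameCoeff_smul {y : N} (hy : y ∈ e.baseSet) (k) (c : ℝ) (v : TangentSpace J y) :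
    frameCoeff e k y (c • v) = c * frameCoeff e k y v := by
  simp [frameCoeff, (e.linear ℝ hy).map_smul]

theorem frameCoeff_frameField {y : N} (hy : y ∈ e.baseSet) (k l) :
    frameCoeff e k y (frameField e l y) = if k = l then 1 else 0 := by
  simp [frameCoeff, frameField, snd_constField hy, Finsupp.single_apply, eq_comm]

/-- Smoothness at `x` of a vector field `σ` along the map `u`. -/
def SmoothAlongAt (I : ModelWithCorners ℝ E H) (u : M → N) (σ : Π x : M, TangentSpace J (u x))
    (x : M) : Prop :=
  ContMDiffAt I J.tangent ∞ (fun y => (⟨u y, σ y⟩ : TangentBundle J N)) x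

theorem contMDiffAt_constField {y : N} (hy : y ∈ e.baseSet) (a : F) :
    ContMDiffAt J J.tangent ∞ (fun z => (⟨z, constField e a z⟩ : TangentBundle J N)) y := by
  rw [e.contMDiffAt_section_iff hy]
  refine (contMDiffAt_const (c := a)).congr_of_eventuallyEq ?_
  filter_upwards [e.open_baseSet.mem_nhds hy] with z hz
  exact snd_constField hz a

theorem mdifferentiableAt_constField {y : N} (hy : y ∈ e.baseSet) (a : F) :
    MDiffAt (T% (constField e a)) y :=
  (contMDiffAt_constField hy a).mdifferentiableAt (by simp)

theorem smoothAlongAt_iff {u : M → N} {σ : Π x : M, TangentSpace J (u x)} {x : M}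
    (hx : u x ∈ e.baseSet) :
    SmoothAlongAt I u σ x ↔ ContMDiffAt I J ∞ u x ∧
      ∀ k, ContMDiffAt I 𝓘(ℝ) ∞ (fun y => frameCoeff e k (u y) (σ y)) x := by
  have h := e.contMDiffAt_iff (IB := J) (IM := I) (n := ∞)
    (f := fun y => (⟨u y, σ y⟩ : TangentBundle J N)) (x₀ := x) (by simpa [e.mem_source] using hx)
  refine h.trans (and_congr_right fun _ => ⟨fun h k => ?_, fun h => ?_⟩)
  · exact ((Module.finBasis ℝ F).coord k).toContinuousLinearMap.contMDiff.contMDiffAt.comp x h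
  · have : (fun y => (e ⟨u y, σ y⟩).2)
        = fun y => ∑ k, frameCoeff e k (u y) (σ y) • Module.finBasis ℝ F k := by
      funext y
      exact ((Module.finBasis ℝ F).sum_repr (e ⟨u y, σ y⟩).2).symm
    rw [this]
    exact contMDiffAt_finsetSum fun k _ => (h k).smul contMDiffAt_const

theorem mdifferentiableAt_frameCoeff {u : M → N} {σ : Π x : M, TangentSpace J (u x)} {x : M}
    (hx : u x ∈ e.baseSet) (h : SmoothAlongAt I u σ x) (k) :
    MDiffAt (fun y => frameCoeff e k (u y) (σ y)) x :=
  (((smoothAlongAt_iff hx).1 h).2 k).mdifferentiableAt (by simp)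

end Frames

/-! ### Connections and induced connections in a local frame -/

section Connections

variable {E : Type*} [NormedAddCommGroup E] [NormedSpace ℝ E]
  {H : Type*} [TopologicalSpace H] {I : ModelWithCorners ℝ E H}
  {M : Type*} [TopologicalSpace M] [ChartedSpace H M]
  {F : Type*} [NormedAddCommGroup F] [NormedSpace ℝ F] [FiniteDimensional ℝ F]
  {G : Type*} [TopologicalSpace G] {J : ModelWithCorners ℝ F G}
  {N : Type*} [TopologicalSpace N] [ChartedSpace G N] [IsManifold J ∞ N]
  {e : Trivialization F (TotalSpace.proj : TotalSpace F (TangentSpace J : N → Type _) → N)}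
  [MemTrivializationAtlas e]

theorem mdifferentiableAt_snd_section {y : N} (hy : y ∈ e.baseSet) {s : Π y : N, TangentSpace J y}
    (hs : MDiffAt (T% s) y) : MDiffAt (fun z => (e ⟨z, s z⟩).2) y :=
  (e.mdifferentiableAt_section_iff J s hy).1 hs

/-- A connection in terms of the coefficients with respect to a trivialization. -/
theorem connection_eq (D : AffineConnection J N) {y : N} (hy : y ∈ e.baseSet)
    {s : Π y : N, TangentSpace J y} (hs : MDiffAt (T% s) y) (w : TangentSpace J y) :
    D s y w = e.symmL ℝ y (mvfderiv J (fun z => (e ⟨z, s z⟩).2) y w)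
      + D (constField e (e ⟨y, s y⟩).2) y w := by
  -- `D` minus the coordinate derivative is tensorial, so it may be evaluated on the
  -- constant-coefficient field with the same value, whose coordinate derivative vanishes.
  let Φ : (Π y : N, TangentSpace J y) → TangentSpace J y := fun s =>
    D s y w - e.symmL ℝ y (mvfderiv J (fun z => (e ⟨z, s z⟩).2) y w)
  have hev := e.open_baseSet.mem_nhds hy
  have hΦ : TensorialAt J F Φ y := by
    refine ⟨fun {f s} hf hs => ?_, fun {s t} hs ht => ?_⟩
    · have h : (fun z => (e ⟨z, (f • s) z⟩).2) =ᶠ[nhds y] fun z => f z • (e ⟨z, s z⟩).2 := by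
        filter_upwards [hev] with z hz
        exact (e.linear ℝ hz).map_smul _ _
      have h2 : e.symmL ℝ y (e ⟨y, s y⟩).2 = s y := by
        exact constField_snd hy _
      simp only [Φ]
      rw [h.mvfderiv_eq, mvfderiv_fun_smul hf (mdifferentiableAt_snd_section hy hs),
        D.isCovariantDerivativeOn.leibniz hs hf]
      simp [h2, smul_sub]
    · have h : (fun z => (e ⟨z, (s + t) z⟩).2)
          =ᶠ[nhds y] fun z => (e ⟨z, s z⟩).2 + (e ⟨z, t z⟩).2 := by
        filter_upwards [hev] with z hz
        exact (e.linear ℝ hz).map_add _ _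
      simp only [Φ]
      rw [h.mvfderiv_eq, mvfderiv_fun_add (mdifferentiableAt_snd_section hy hs)
        (mdifferentiableAt_snd_section hy ht), D.isCovariantDerivativeOn.add hs ht]
      simp only [add_apply, map_add]
      abel
  have h1 := hΦ.pointwise hs (mdifferentiableAt_constField hy (e ⟨y, s y⟩).2)
    (constField_snd hy (s y)).symm
  have h2 : (fun z => (e ⟨z, constField e (e ⟨y, s y⟩).2 z⟩).2)
      =ᶠ[nhds y] fun _ => (e ⟨y, s y⟩).2 := by
    filter_upwards [hev] with z hz
    exact snd_constField hz _
  simp only [Φ] at h1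
  rw [h2.mvfderiv_eq, mvfderiv_const] at h1
  simp only [zero_apply, map_zero, sub_zero] at h1
  rw [← h1]
  abel

theorem connection_constField_sum (D : AffineConnection J N) {y : N} (hy : y ∈ e.baseSet)
    {ι : Type*} (s : Finset ι) (c : ι → ℝ) (a : ι → F) :
    D (constField e (∑ i ∈ s, c i • a i)) y = ∑ i ∈ s, c i • D (constField e (a i)) y := by
  classical
  induction s using Finset.induction_on with
  | empty =>
    have : constField e (0 : F) = (0 : Π y : N, TangentSpace J y) := by
      funext z; simp [constField]
    simp [this, CovariantDerivative.zero]
  | insert i s hi ih =>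
    have : constField e (c i • a i + ∑ j ∈ s, c j • a j)
        = c i • constField e (a i) + constField e (∑ j ∈ s, c j • a j) := by
      funext z
      simp [constField]
    have hc : MDiffAt (T% (c i • constField e (a i))) y := by
      have : c i • constField e (a i) = constField e (c i • a i) := by
        funext z; simp [constField]
      rw [this]
      exact mdifferentiableAt_constField hy _
    rw [Finset.sum_insert hi, Finset.sum_insert hi, this, D.isCovariantDerivativeOn.add hc
      (mdifferentiableAt_constField hy _), ih,
      D.isCovariantDerivativeOn.smul_const _ (mdifferentiableAt_constField hy _)]

/-- The induced connection in terms of the local frame given by a trivialization. -/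
theorem pullback_eq_sum (D : AffineConnection J N) {u : M → N}
    {σ : Π x : M, TangentSpace J (u x)} {x : M} (hx : u x ∈ e.baseSet)
    (hσ : SmoothAlongAt I u σ x) (v : TangentSpace I x) :
    pullback D u σ x v = ∑ k, (mvfderiv I (fun y => frameCoeff e k (u y) (σ y)) x v
        • frameField e k (u x)
      + frameCoeff e k (u x) (σ x) • D (frameField e k) (u x) (mfderiv I J u x v)) := by
  have hu : MDiffAt u x := ((smoothAlongAt_iff hx).1 hσ).1.mdifferentiableAt (by simp)
  -- The definition of `pullback` uses the trivialization centred at `u x`, which moves with `x`.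
  -- The frame of the fixed `e` has coefficients `t k` in it; their derivatives are absorbed into `D
  -- (frameField e k)` by `connection_eq`.
  let e₀ := trivializationAt F (fun y : N => TangentSpace J y) (u x)
  have hx₀ : u x ∈ e₀.baseSet := FiberBundle.mem_baseSet_trivializationAt' (u x)
  let t (k) (q : N) : F := (e₀ ⟨q, frameField e k q⟩).2
  have ht (k) : MDiffAt (t k) (u x) :=
    mdifferentiableAt_snd_section hx₀ (mdifferentiableAt_constField hx _)
  have hdec (y : M) (hy : u y ∈ e.baseSet) (hy₀ : u y ∈ e₀.baseSet) :
      (e₀ ⟨u y, σ y⟩).2 = ∑ k, frameCoeff e k (u y) (σ y) • t k (u y) := by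
    conv_lhs => rw [← sum_frameCoeff hy (σ y)]
    have := map_sum (e₀.linearMapAt ℝ (u y))
      (fun k => frameCoeff e k (u y) (σ y) • frameField e k (u y)) Finset.univ
    simp only [map_smul, e₀.coe_linearMapAt_of_mem hy₀] at this
    exact this
  have hev : (fun y => (e₀ ⟨u y, σ y⟩).2)
      =ᶠ[nhds x] fun y => ∑ k, frameCoeff e k (u y) (σ y) • t k (u y) := by
    filter_upwards [hu.continuousAt.preimage_mem_nhds (e.open_baseSet.mem_nhds hx),
      hu.continuousAt.preimage_mem_nhds (e₀.open_baseSet.mem_nhds hx₀)] with y hy hy₀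
    exact hdec y hy hy₀
  have hc (k) := mdifferentiableAt_frameCoeff hx hσ k
  have htu (k) : MDiffAt (fun y => t k (u y)) x := (ht k).comp x hu
  have hd : mvfderiv I (fun y => (e₀ ⟨u y, σ y⟩).2) x v
      = ∑ k, (frameCoeff e k (u x) (σ x) • mvfderiv J (t k) (u x) (mfderiv I J u x v)
        + mvfderiv I (fun y => frameCoeff e k (u y) (σ y)) x v • t k (u x)) := by
    rw [hev.mvfderiv_eq, mvfderiv_fun_sum (f := fun k y => frameCoeff e k (u y) (σ y) • t k (u y)) _
      fun k _ => (hc k).smul (htu k)]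
    simp only [sum_apply]
    refine Finset.sum_congr rfl fun k _ => ?_
    rw [mvfderiv_fun_smul (hc k) (htu k), mvfderiv_comp_map (ht k) hu]
    simp
  have hD : D (FiberBundle.extend F (σ x)) (u x)
      = ∑ k, frameCoeff e k (u x) (σ x) • D (constField e₀ (t k (u x))) (u x) := by
    rw [← connection_constField_sum D hx₀, ← hdec x hx hx₀]
    exact D.isCovariantDerivativeOn.congr_of_eventuallyEq
      (FiberBundle.mdifferentiableAt_extend ..) (mdifferentiableAt_constField hx₀ _)
      Filter.univ_mem (eventuallyEq_extend _ _)
  have hs (k) := connection_eq D hx₀ (s := frameField e k) (mdifferentiableAt_constField hx _)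
    (mfderiv I J u x v)
  have ht' (k) : e₀.symmL ℝ (u x) (t k (u x)) = frameField e k (u x) := by
    exact constField_snd hx₀ _
  change e₀.symmL ℝ (u x) (mvfderiv I (fun y => (e₀ ⟨u y, σ y⟩).2) x v)
    + D (FiberBundle.extend F (σ x)) (u x) (mfderiv I J u x v) = _
  rw [hd, hD, map_sum, sum_apply,
    ← Finset.sum_add_distrib]
  refine Finset.sum_congr rfl fun k _ => ?_
  rw [hs k, map_add, map_smul, map_smul, ht']
  simp only [smul_apply, smul_add]
  abel

end Connections

/-! ### Algebra of bilinear expansions -/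

section Bilinear

variable {V : Type*} [AddCommGroup V] [Module ℝ V] {ι κ : Type*} [Fintype ι] [Fintype κ]

theorem IsBilinearMap.sum_sum {B : V → V → ℝ} (hB : IsBilinearMap ℝ B) (a : ι → ℝ) (s : ι → V)
    (b : κ → ℝ) (t : κ → V) :
    B (∑ k, a k • s k) (∑ l, b l • t l) = ∑ k, ∑ l, a k * (b l * B (s k) (t l)) := by
  change hB.toLinearMap (∑ k, a k • s k) (∑ l, b l • t l)
    = ∑ k, ∑ l, a k * (b l * hB.toLinearMap (s k) (t l))
  simp only [map_sum, map_smul, LinearMap.sum_apply, LinearMap.smul_apply, smul_eq_mul,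
    Finset.mul_sum]
  rw [Finset.sum_comm]
  congr! 2
  ring

/-- Bookkeeping for the product rule of a metric: `s` is a frame, `t` its covariant derivative, `a'`
and `b'` the derivatives of the coefficients, and `C` the defect `∇g`. -/
theorem IsBilinearMap.sum_product_rule {B C : V → V → ℝ} (hB : IsBilinearMap ℝ B)
    (hC : IsBilinearMap ℝ C) (a b a' b' : ι → ℝ) (s t : ι → V) :
    ∑ k, ∑ l, (a k * (b l * (B (t k) (s l) + B (s k) (t l) + C (s k) (s l)))
        + a' k * (b l * B (s k) (s l)) + a k * (b' l * B (s k) (s l)))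
      = B (∑ k, (a' k • s k + a k • t k)) (∑ k, b k • s k)
        + B (∑ k, a k • s k) (∑ k, (b' k • s k + b k • t k))
        + C (∑ k, a k • s k) (∑ k, b k • s k) := by
  rw [Finset.sum_add_distrib, Finset.sum_add_distrib, hB.add_left, hB.add_right]
  simp only [hB.sum_sum, hC.sum_sum, ← Finset.sum_add_distrib]
  congr! 2
  ring

end Bilinear

/-! ### The product rule for a metric along a map -/

section Metrics

variable {E : Type*} [NormedAddCommGroup E] [NormedSpace ℝ E]
  {H : Type*} [TopologicalSpace H] {I : ModelWithCorners ℝ E H}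
  {M : Type*} [TopologicalSpace M] [ChartedSpace H M]
  {F : Type*} [NormedAddCommGroup F] [NormedSpace ℝ F] [FiniteDimensional ℝ F]
  {G : Type*} [TopologicalSpace G] {J : ModelWithCorners ℝ F G}
  {N : Type*} [TopologicalSpace N] [ChartedSpace G N] [IsManifold J ∞ N]
  {e : Trivialization F (TotalSpace.proj : TotalSpace F (TangentSpace J : N → Type _) → N)}
  [MemTrivializationAtlas e]

/-- Smoothness of the vector field `Y` at `z`. -/
abbrev SmoothFieldAt (Y : Π z : N, TangentSpace J z) (z : N) : Prop :=
  SmoothAlongAt J (fun z : N => z) Y z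

theorem SmoothFieldAt.mdifferentiableAt {Y : Π z : N, TangentSpace J z} {z : N}
    (h : SmoothFieldAt Y z) : MDiffAt (T% Y) z :=
  ContMDiffAt.mdifferentiableAt h (by simp)

theorem SmoothAlongAt.base {u : M → N} {σ : Π x : M, TangentSpace J (u x)} {x : M}
    (h : SmoothAlongAt I u σ x) : ContMDiffAt I J ∞ u x :=
  (contMDiffAt_totalSpace.1 h).1

theorem smoothFieldAt_frameField {y : N} (hy : y ∈ e.baseSet) (k) :
    SmoothFieldAt (frameField e k) y := contMDiffAt_constField hy _

theorem SmoothAlongAt.inner (g : Metric J N) {u : M → N} {σ ρ : Π x : M, TangentSpace J (u x)}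
    {x : M} (hσ : SmoothAlongAt I u σ x) (hρ : SmoothAlongAt I u ρ x) :
    ContMDiffAt I 𝓘(ℝ) ∞ (fun y => g.inner (u y) (σ y) (ρ y)) x := by
  have : ContMDiffAt I (J.prod 𝓘(ℝ)) ∞
      (fun m ↦ TotalSpace.mk' ℝ (E := Bundle.Trivial N ℝ) (u m) (g.inner (u m) (σ m) (ρ m))) x :=
    ContMDiffAt.clm_bundle_apply₂ (F₁ := F) (F₂ := F)
      (g.contMDiff.contMDiffAt.comp x hσ.base) hσ hρ
  simp only [contMDiffAt_totalSpace] at this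
  exact this.2

theorem isBilinearMap_inner (g : Metric J N) (y : N) :
    IsBilinearMap ℝ (fun v w : TangentSpace J y => g.inner y v w) :=
  ⟨fun _ _ _ => by rw [map_add, add_apply], fun _ _ _ => by rw [map_smul, smul_apply],
    fun _ _ _ => map_add _ _ _, fun _ _ _ => map_smul _ _ _⟩

theorem isBilinearMap_nablaMetric (g : Metric J N) (D : AffineConnection J N) (y : N)
    (v : TangentSpace J y) :
    IsBilinearMap ℝ (fun z w : TangentSpace J y => nablaMetric g D y z w v) :=
  ⟨fun a b z => congrArg (fun T : TangentSpace J y →L[ℝ] TangentSpace J y →L[ℝ] ℝ => T z v)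
      ((nablaMetric g D y).map_add a b),
    fun c a z => congrArg (fun T : TangentSpace J y →L[ℝ] TangentSpace J y →L[ℝ] ℝ => T z v)
      ((nablaMetric g D y).map_smul c a),
    fun _ _ _ => by rw [map_add, add_apply], fun _ _ _ => by rw [map_smul, smul_apply]⟩

theorem inner_eq_sum_frameCoeff (g : Metric J N) {y : N} (hy : y ∈ e.baseSet)
    (v w : TangentSpace J y) :
    g.inner y v w = ∑ k, ∑ l, frameCoeff e k y v * (frameCoeff e l y w
      * g.inner y (frameField e k y) (frameField e l y)) := by
  conv_lhs => rw [← sum_frameCoeff hy v, ← sum_frameCoeff hy w]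
  exact (isBilinearMap_inner g y).sum_sum ..

/-- The product rule for the metric along a map. -/
theorem mvfderiv_inner_along (g : Metric J N) (D : AffineConnection J N) {u : M → N}
    {σ ρ : Π x : M, TangentSpace J (u x)} {x : M} (hσ : SmoothAlongAt I u σ x)
    (hρ : SmoothAlongAt I u ρ x) (v : TangentSpace I x) :
    mvfderiv I (fun y => g.inner (u y) (σ y) (ρ y)) x v
      = g.inner (u x) (pullback D u σ x v) (ρ x) + g.inner (u x) (σ x) (pullback D u ρ x v)
        + nablaMetric g D (u x) (σ x) (ρ x) (mfderiv I J u x v) := by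
  let e := trivializationAt F (fun y : N => TangentSpace J y) (u x)
  have hx : u x ∈ e.baseSet := FiberBundle.mem_baseSet_trivializationAt' (u x)
  have hu := hσ.base.mdifferentiableAt (by simp)
  have hs (k) : MDiffAt (T% (frameField e k)) (u x) := mdifferentiableAt_constField hx _
  have hg (k l) := mdifferentiableAt_inner g (hs k) (hs l)
  have hgu (k l) : MDiffAt (fun y => g.inner (u y) (frameField e k (u y))
    (frameField e l (u y))) x := (hg k l).comp x hu
  have ha (k) := mdifferentiableAt_frameCoeff hx hσ k
  have hb (k) := mdifferentiableAt_frameCoeff hx hρ k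
  have hev : (fun y => g.inner (u y) (σ y) (ρ y)) =ᶠ[nhds x] fun y => ∑ k, ∑ l,
      frameCoeff e k (u y) (σ y) * (frameCoeff e l (u y) (ρ y)
        * g.inner (u y) (frameField e k (u y)) (frameField e l (u y))) := by
    filter_upwards [hu.continuousAt.preimage_mem_nhds (e.open_baseSet.mem_nhds hx)] with y hy
    exact inner_eq_sum_frameCoeff g hy _ _
  have hN (k l) := nablaMetric_apply g D (hs k) (hs l) (mfderiv I J u x v)
  have hterm (k l) : MDiffAt (fun y => frameCoeff e k (u y) (σ y) * (frameCoeff e l (u y) (ρ y)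
        * g.inner (u y) (frameField e k (u y)) (frameField e l (u y)))) x :=
    (ha k).mul ((hb l).mul (hgu k l))
  have hterm' (k) : MDiffAt (fun y => ∑ l, frameCoeff e k (u y) (σ y) *
      (frameCoeff e l (u y) (ρ y)
        * g.inner (u y) (frameField e k (u y)) (frameField e l (u y)))) x := by
    have hl (l) : ContMDiffAt I 𝓘(ℝ) ∞ (fun y => frameCoeff e k (u y) (σ y) *
      (frameCoeff e l (u y) (ρ y)
        * g.inner (u y) (frameField e k (u y)) (frameField e l (u y)))) x := by
      have hf (k) : SmoothAlongAt I u (fun y => frameField e k (u y)) x :=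
        (contMDiffAt_constField hx _).comp x hσ.base
      exact (((smoothAlongAt_iff hx).1 hσ).2 k).mul
        ((((smoothAlongAt_iff hx).1 hρ).2 l).mul ((hf k).inner g (hf l)))
    exact (contMDiffAt_finsetSum fun l _ => hl l).mdifferentiableAt (by simp)
  rw [hev.mvfderiv_eq, mvfderiv_fun_sum _ fun k _ => hterm' k]
  -- On frame fields the rule is the defining property of `∇g`, composed with `u`; the coefficients
  -- contribute the ordinary product rule.
  have hd (k l) : mvfderiv I (fun y => frameCoeff e k (u y) (σ y) * (frameCoeff e l (u y) (ρ y)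
        * g.inner (u y) (frameField e k (u y)) (frameField e l (u y)))) x v
      = frameCoeff e k (u x) (σ x) * (frameCoeff e l (u x) (ρ x)
          * (g.inner (u x) (D (frameField e k) (u x) (mfderiv I J u x v)) (frameField e l (u x))
            + g.inner (u x) (frameField e k (u x)) (D (frameField e l) (u x) (mfderiv I J u x v))
            + nablaMetric g D (u x) (frameField e k (u x)) (frameField e l (u x))
              (mfderiv I J u x v)))
        + mvfderiv I (fun y => frameCoeff e k (u y) (σ y)) x v * (frameCoeff e l (u x) (ρ x)
          * g.inner (u x) (frameField e k (u x)) (frameField e l (u x)))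
        + frameCoeff e k (u x) (σ x) * (mvfderiv I (fun y => frameCoeff e l (u y) (ρ y)) x v
          * g.inner (u x) (frameField e k (u x)) (frameField e l (u x))) := by
    rw [mvfderiv_fun_mul (g := fun y => frameCoeff e l (u y) (ρ y)
        * g.inner (u y) (frameField e k (u y)) (frameField e l (u y))) (ha k)
      ((hb l).mul (hgu k l)), mvfderiv_fun_mul (hb l) (hgu k l),
      mvfderiv_comp_map (hg k l) hu, hN]
    simp only [add_apply, smul_apply, smul_eq_mul, ContinuousLinearMap.comp_apply]
    ring
  simp only [sum_apply]
  have hsum (k) := congrArg (fun T => T v) (mvfderiv_fun_sum (I := I) Finset.univ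
    fun l _ => hterm k l)
  simp only [sum_apply] at hsum
  simp only [hsum, hd]
  rw [pullback_eq_sum D hx hσ, pullback_eq_sum D hx hρ]
  have h := (isBilinearMap_inner g (u x)).sum_product_rule
    (isBilinearMap_nablaMetric g D (u x) (mfderiv I J u x v))
    (fun k => frameCoeff e k (u x) (σ x)) (fun k => frameCoeff e k (u x) (ρ x))
    (fun k => mvfderiv I (fun y => frameCoeff e k (u y) (σ y)) x v)
    (fun k => mvfderiv I (fun y => frameCoeff e k (u y) (ρ y)) x v)
    (fun k => frameField e k (u x))
    (fun k => D (frameField e k) (u x) (mfderiv I J u x v))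
  rw [sum_frameCoeff hx (σ x), sum_frameCoeff hx (ρ x)] at h
  exact h

end Metrics

/-! ### Smoothness tested by inner products -/

section Musical

variable {F : Type*} [NormedAddCommGroup F] [NormedSpace ℝ F] [FiniteDimensional ℝ F]
  {G : Type*} [TopologicalSpace G] {J : ModelWithCorners ℝ F G}
  {N : Type*} [TopologicalSpace N] [ChartedSpace G N] [IsManifold J ∞ N]
  {e : Trivialization F (TotalSpace.proj : TotalSpace F (TangentSpace J : N → Type _) → N)}
  [MemTrivializationAtlas e]

variable (e) in
/-- The metric in the trivialization `e`. -/
def gram (g : Metric J N) (z : N) : F →L[ℝ] F →L[ℝ] ℝ :=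
  ∑ k, ∑ l, g.inner z (frameField e k z) (frameField e l z) •
    ((Module.finBasis ℝ F).coord k).toContinuousLinearMap.smulRight
      ((Module.finBasis ℝ F).coord l).toContinuousLinearMap

theorem gram_snd (g : Metric J N) {z : N} (hz : z ∈ e.baseSet) (v : TangentSpace J z) :
    gram e g z (e ⟨z, v⟩).2 = ∑ l, g.inner z v (frameField e l z) •
      ((Module.finBasis ℝ F).coord l).toContinuousLinearMap := by
  have h (l) : g.inner z v (frameField e l z)
      = ∑ k, frameCoeff e k z v * g.inner z (frameField e k z) (frameField e l z) := by
    conv_lhs => rw [← sum_frameCoeff hz v]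
    rw [map_sum, sum_apply]
    exact Finset.sum_congr rfl fun k _ => by rw [map_smul, smul_apply, smul_eq_mul]
  ext w
  simp only [gram, h, sum_apply, smul_apply, ContinuousLinearMap.smulRight_apply, smul_eq_mul,
    Finset.sum_mul]
  rw [Finset.sum_comm]
  refine Finset.sum_congr rfl fun l _ => Finset.sum_congr rfl fun k _ => ?_
  simp only [frameCoeff, LinearMap.coe_toContinuousLinearMap']
  ring

theorem gram_injective (g : Metric J N) {z : N} (hz : z ∈ e.baseSet) :
    Function.Injective (gram e g z) := by
  rw [injective_iff_map_eq_zero]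
  intro a ha
  by_contra hne
  have hc : constField e a z ≠ 0 := fun h => hne (by
    have h2 := snd_constField hz a
    rw [h] at h2
    rw [← h2]
    exact (e.linear ℝ hz).map_zero)
  have hpos := g.pos z _ hc
  have h1 := gram_snd g hz (constField e a z)
  rw [snd_constField hz, ha] at h1
  have h2 : g.inner z (constField e a z) (constField e a z) = 0 := by
    conv_lhs => rw [← sum_frameCoeff hz (constField e a z)]
    rw [sum_frameCoeff hz (constField e a z)]
    -- If the Gram map kills `a`, evaluating the resulting functional at `a` itself gives the
    -- squared norm of the field with coefficients `a`, contradicting positivity.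
    have h3 := congrArg (fun T => T a) h1
    conv_lhs => enter [2]; rw [← sum_frameCoeff hz (constField e a z)]
    simp only [zero_apply, sum_apply, smul_apply, smul_eq_mul,
      LinearMap.coe_toContinuousLinearMap'] at h3
    rw [map_sum, h3]
    refine Finset.sum_congr rfl fun l _ => ?_
    rw [map_smul, frameCoeff, snd_constField hz, smul_eq_mul, mul_comm]
  exact hpos.ne' h2

theorem exists_gram_equiv (g : Metric J N) {z : N} (hz : z ∈ e.baseSet) :
    ∃ T : F ≃L[ℝ] (F →L[ℝ] ℝ), (T : F →L[ℝ] F →L[ℝ] ℝ) = gram e g z := by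
  have hdim : Module.finrank ℝ F = Module.finrank ℝ (F →L[ℝ] ℝ) := by
    rw [← Subspace.dual_finrank_eq (K := ℝ) (V := F)]
    exact LinearEquiv.finrank_eq LinearMap.toContinuousLinearMap
  refine ⟨(LinearEquiv.ofInjectiveOfFinrankEq (gram e g z).toLinearMap
    (gram_injective g hz) hdim).toContinuousLinearEquiv, ?_⟩
  ext a b
  rfl

theorem contMDiffAt_gram (g : Metric J N) {y : N} (hy : y ∈ e.baseSet) :
    ContMDiffAt J 𝓘(ℝ, F →L[ℝ] F →L[ℝ] ℝ) ∞ (gram e g) y := by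
  refine contMDiffAt_finsetSum fun k _ => contMDiffAt_finsetSum fun l _ => ?_
  exact ((smoothFieldAt_frameField hy k).inner g (smoothFieldAt_frameField hy l)).smul
    contMDiffAt_const

/-- A vector field is smooth if its inner products with the fields of a local frame are. -/
theorem smoothFieldAt_of_inner (g : Metric J N) {y : N} (hy : y ∈ e.baseSet)
    {σ : Π z : N, TangentSpace J z}
    (h : ∀ k, ContMDiffAt J 𝓘(ℝ) ∞ (fun z => g.inner z (σ z) (frameField e k z)) y) :
    SmoothFieldAt σ y := by
  refine (e.contMDiffAt_section_iff (IB := J) (n := ∞) (s := σ) hy).2 ?_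
  -- The coefficients of `σ` come from its inner products by inverting the Gram map, and operator
  -- inversion is smooth at an invertible operator.
  have hev : (fun z => (e ⟨z, σ z⟩).2) =ᶠ[nhds y] fun z =>
      (gram e g z).inverse (∑ l, g.inner z (σ z) (frameField e l z) •
        ((Module.finBasis ℝ F).coord l).toContinuousLinearMap) := by
    filter_upwards [e.open_baseSet.mem_nhds hy] with z hz
    obtain ⟨T, hT⟩ := exists_gram_equiv g hz
    rw [← gram_snd g hz, ← hT, ContinuousLinearMap.inverse_equiv]
    simp
  refine ContMDiffAt.congr_of_eventuallyEq ?_ hev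
  obtain ⟨T, hT⟩ := exists_gram_equiv g hy
  have hinv : ContDiffAt ℝ ∞ ContinuousLinearMap.inverse (gram e g y) := by
    rw [← hT]
    exact contDiffAt_map_inverse T
  have h1 : ContMDiffAt J 𝓘(ℝ, (F →L[ℝ] ℝ) →L[ℝ] F) ∞ (fun z => (gram e g z).inverse) y :=
    hinv.contMDiffAt.comp y (contMDiffAt_gram g hy)
  exact h1.clm_apply (contMDiffAt_finsetSum fun l _ => (h l).smul contMDiffAt_const)

end Musical

/-! ### Leibniz rules, and smoothness of pushforwards -/

section Leibniz

variable {E : Type*} [NormedAddCommGroup E] [NormedSpace ℝ E]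
  {H : Type*} [TopologicalSpace H] {I : ModelWithCorners ℝ E H}
  {M : Type*} [TopologicalSpace M] [ChartedSpace H M]
  {F : Type*} [NormedAddCommGroup F] [NormedSpace ℝ F] [FiniteDimensional ℝ F]
  {G : Type*} [TopologicalSpace G] {J : ModelWithCorners ℝ F G}
  {N : Type*} [TopologicalSpace N] [ChartedSpace G N] [IsManifold J ∞ N]

theorem connection_congr (D : AffineConnection J N) {y : N} {s t : Π y : N, TangentSpace J y}
    (hs : MDiffAt (T% s) y) (ht : MDiffAt (T% t) y) (h : ∀ᶠ z in nhds y, s z = t z) :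
    D s y = D t y :=
  D.isCovariantDerivativeOn.congr_of_eventuallyEq hs ht Filter.univ_mem h

theorem eventually_extend_add {y : N} (v w : TangentSpace J y) :
    ∀ᶠ z in nhds y, FiberBundle.extend F (v + w) z
      = (FiberBundle.extend F v + FiberBundle.extend F w) z := by
  filter_upwards [eventuallyEq_extend y v, eventuallyEq_extend y w, eventuallyEq_extend y (v + w)]
    with z h1 h2 h3
  rw [Pi.add_apply, h1, h2, h3, ((trivializationAt F (TangentSpace J) y).linear ℝ
    (FiberBundle.mem_baseSet_trivializationAt' y)).map_add]
  simp [constField]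

theorem eventually_extend_smul {y : N} (c : ℝ) (v : TangentSpace J y) :
    ∀ᶠ z in nhds y, FiberBundle.extend F (c • v) z = (c • FiberBundle.extend F v) z := by
  filter_upwards [eventuallyEq_extend y v, eventuallyEq_extend y (c • v)] with z h1 h3
  rw [Pi.smul_apply, h1, h3, ((trivializationAt F (TangentSpace J) y).linear ℝ
    (FiberBundle.mem_baseSet_trivializationAt' y)).map_smul]
  simp [constField]

theorem connection_extend_add (D : AffineConnection J N) {y : N} (v w : TangentSpace J y) :
    D (FiberBundle.extend F (v + w)) y
      = D (FiberBundle.extend F v) y + D (FiberBundle.extend F w) y := by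
  rw [← D.isCovariantDerivativeOn.add (FiberBundle.mdifferentiableAt_extend ..)
    (FiberBundle.mdifferentiableAt_extend ..)]
  exact connection_congr D (FiberBundle.mdifferentiableAt_extend ..)
    (mdifferentiableAt_add_section (FiberBundle.mdifferentiableAt_extend ..)
      (FiberBundle.mdifferentiableAt_extend ..)) (eventually_extend_add v w)

theorem connection_extend_smul (D : AffineConnection J N) {y : N} (c : ℝ) (v : TangentSpace J y) :
    D (FiberBundle.extend F (c • v)) y = c • D (FiberBundle.extend F v) y := by
  rw [← D.isCovariantDerivativeOn.smul_const c (FiberBundle.mdifferentiableAt_extend ..)]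
  exact connection_congr D (FiberBundle.mdifferentiableAt_extend ..)
    (mdifferentiableAt_const.smul_section (FiberBundle.mdifferentiableAt_extend ..))
      (eventually_extend_smul c v)

theorem pullback_add (D : AffineConnection J N) {u : M → N} {σ ρ : Π x : M, TangentSpace J (u x)}
    {x : M} (hσ : MDiffAt (fun y => (⟨u y, σ y⟩ : TangentBundle J N)) x)
    (hρ : MDiffAt (fun y => (⟨u y, ρ y⟩ : TangentBundle J N)) x) :
    pullback (I := I) D u (σ + ρ) x = pullback D u σ x + pullback D u ρ x := by
  have h1 := (mdifferentiableAt_totalSpace J _).1 hσ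
  have h2 := (mdifferentiableAt_totalSpace J _).1 hρ
  have hev : (fun y => (trivializationAt F (TangentSpace J) (u x) ⟨u y, (σ + ρ) y⟩).2)
      =ᶠ[nhds x] fun y => (trivializationAt F (TangentSpace J) (u x) ⟨u y, σ y⟩).2
        + (trivializationAt F (TangentSpace J) (u x) ⟨u y, ρ y⟩).2 := by
    filter_upwards [h1.1.continuousAt.preimage_mem_nhds
      ((trivializationAt F (TangentSpace J) (u x)).open_baseSet.mem_nhds
        (FiberBundle.mem_baseSet_trivializationAt' (u x)))] with y hy
    exact (Trivialization.linear ℝ _ hy).map_add _ _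
  ext v
  simp only [pullback]
  rw [hev.mvfderiv_eq, mvfderiv_fun_add h1.2 h2.2, Pi.add_apply, connection_extend_add]
  simp only [add_apply, ContinuousLinearMap.comp_apply, map_add]
  abel

theorem pullback_smul (D : AffineConnection J N) {u : M → N} {σ : Π x : M, TangentSpace J (u x)}
    {f : M → ℝ} {x : M} (hf : MDiffAt f x)
    (hσ : MDiffAt (fun y => (⟨u y, σ y⟩ : TangentBundle J N)) x) (v : TangentSpace I x) :
    pullback D u (fun y => f y • σ y) x v
      = f x • pullback D u σ x v + mvfderiv I f x v • σ x := by
  have h1 := (mdifferentiableAt_totalSpace J _).1 hσ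
  have hx := FiberBundle.mem_baseSet_trivializationAt' (F := F) (E := (TangentSpace J)) (u x)
  have hev : (fun y => (trivializationAt F (TangentSpace J) (u x) ⟨u y, f y • σ y⟩).2)
      =ᶠ[nhds x] fun y => f y • (trivializationAt F (TangentSpace J) (u x) ⟨u y, σ y⟩).2 := by
    filter_upwards [h1.1.continuousAt.preimage_mem_nhds
      ((trivializationAt F (TangentSpace J) (u x)).open_baseSet.mem_nhds hx)] with y hy
    exact (Trivialization.linear ℝ _ hy).map_smul _ _
  simp only [pullback]
  rw [hev.mvfderiv_eq, mvfderiv_fun_smul hf h1.2, connection_extend_smul]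
  have h2 := constField_snd hx (σ x)
  simp only [constField] at h2
  simp only [add_apply, smul_apply, ContinuousLinearMap.comp_apply, map_add, map_smul,
    ContinuousLinearMap.smulRight_apply, smul_add, h2]
  abel

variable [IsManifold I ∞ M]

theorem smoothAlongAt_pushforward {u : M → N} {X : Π x : M, TangentSpace I x} {x : M}
    (hu : ContMDiffAt I J ∞ u x) (hX : SmoothAlongAt I (fun y : M => y) X x) :
    SmoothAlongAt I u (pushforward I J u X) x := by
  have h := hu.mfderiv_const (m := ∞) (by simp)
  exact ContMDiffAt.clm_apply_of_inCoordinates (F₁ := E) (F₂ := F) (b₁ := fun y : M => y)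
    (b₂ := u) h hX hu

theorem contMDiffAt_mvfderiv_apply {f : M → ℝ} {X : Π x : M, TangentSpace I x} {x : M}
    (hf : ContMDiffAt I 𝓘(ℝ) ∞ f x) (hX : SmoothAlongAt I (fun y : M => y) X x) :
    ContMDiffAt I 𝓘(ℝ) ∞ (fun y => mvfderiv I f y (X y)) x :=
  contMDiff_snd_tangentBundle_modelSpace ℝ 𝓘(ℝ) |>.contMDiffAt.comp x
    (smoothAlongAt_pushforward hf hX)

theorem mdifferentiableAt_pushforward {u : M → N} {X : Π x : M, TangentSpace I x} {x : M}
    (hu : ContMDiffAt I J ∞ u x) (hX : MDiffAt (T% X) x) :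
    MDiffAt (fun y => (⟨u y, pushforward I J u X y⟩ : TangentBundle J N)) x := by
  have h := (hu.mfderiv_const (m := ∞) (by simp)).mdifferentiableAt (by simp)
  exact MDifferentiableAt.clm_apply_of_inCoordinates (F₁ := E) (F₂ := F) (b₁ := fun y : M => y)
    (b₂ := u) h hX (hu.mdifferentiableAt (by simp))

end Leibniz

/-! ### Smoothness of connections on local fields -/

section SmoothConnections

variable {F : Type*} [NormedAddCommGroup F] [NormedSpace ℝ F] [FiniteDimensional ℝ F]
  {G : Type*} [TopologicalSpace G] {J : ModelWithCorners ℝ F G}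
  {N : Type*} [TopologicalSpace N] [ChartedSpace G N] [IsManifold J ∞ N]

/-- The connection `D` maps smooth vector fields to smooth vector fields, locally. -/
def SmoothConnection (D : AffineConnection J N) : Prop :=
  ∀ (y : N) (Y Z : Π z : N, TangentSpace J z), (∀ᶠ z in nhds y, SmoothFieldAt Y z) →
    SmoothFieldAt Z y → SmoothFieldAt (fun z => D Y z (Z z)) y

/-- The smoothness axiom speaks of global sections. A local field is multiplied by a bump function
equal to one near the point, which does not change its covariant derivative there; Hausdorffness
makes the product smooth. -/
theorem smoothConnection_of_contMDiff [T2Space N] {D : AffineConnection J N}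
    (h : D.ContMDiffCovariantDerivative ∞) : SmoothConnection D := by
  intro y Y Z hY hZ
  obtain ⟨U, hU, hUo, hyU⟩ := eventually_nhds_iff.1 hY
  obtain ⟨ψ, -, hψ⟩ := (SmoothBumpFunction.nhds_basis_tsupport (I := J) y).mem_iff.1
    (hUo.mem_nhds hyU)
  have hs : ContMDiff J J.tangent ∞ (T% ((ψ : N → ℝ) • Y)) :=
    ContMDiffOn.smul_section_of_tsupport (u := U) ψ.contMDiff.contMDiffOn hUo hψ
      fun z hz => ContMDiffAt.contMDiffWithinAt (hU z hz)
  have h1 := (h.contMDiff.contMDiff (σ := (ψ : N → ℝ) • Y) (by simpa using hs.contMDiffOn))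
    |>.contMDiffAt (x := y) Filter.univ_mem
  have h2 := ContMDiffAt.clm_bundle_apply (F₁ := F) (F₂ := F) (b := fun z : N => z) h1 hZ
  refine ContMDiffAt.congr_of_eventuallyEq h2 ?_
  filter_upwards [ψ.eventuallyEq_one.eventuallyEq_nhds, hUo.mem_nhds hyU] with z hz hzU
  have : D Y z = D ((ψ : N → ℝ) • Y) z := by
    refine connection_congr D (hU z hzU).mdifferentiableAt
      (hs.contMDiffAt.mdifferentiableAt (by simp)) ?_
    filter_upwards [hz] with q hq
    simp [hq]
  exact congrArg (fun w => (⟨z, w⟩ : TangentBundle J N)) (congrArg (fun T => T (Z z)) this)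

theorem SmoothFieldAt.add {Y Z : Π z : N, TangentSpace J z} {y : N} (hY : SmoothFieldAt Y y)
    (hZ : SmoothFieldAt Z y) : SmoothFieldAt (Y + Z) y :=
  ContMDiffAt.add_section hY hZ

theorem SmoothFieldAt.const_smul {Y : Π z : N, TangentSpace J z} {y : N} (c : ℝ)
    (hY : SmoothFieldAt Y y) : SmoothFieldAt (c • Y) y :=
  ContMDiffAt.smul_section contMDiffAt_const hY

/-- The inner products with frame fields are values of `∇g`, and these are built from smooth
functions by the defining formula. -/
theorem smoothFieldAt_conjugateForm (g : Metric J N) {D : AffineConnection J N}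
    (hD : SmoothConnection D) {y : N} {Y Z : Π z : N, TangentSpace J z}
    (hY : ∀ᶠ z in nhds y, SmoothFieldAt Y z) (hZ : SmoothFieldAt Z y) :
    SmoothFieldAt (fun z => conjugateForm g D z (Y z) (Z z)) y := by
  let e := trivializationAt F (fun y : N => TangentSpace J y) y
  have hy : y ∈ e.baseSet := FiberBundle.mem_baseSet_trivializationAt' y
  have he : ∀ᶠ z in nhds y, z ∈ e.baseSet := e.open_baseSet.mem_nhds hy
  refine smoothFieldAt_of_inner g hy fun k => ?_
  have hs : ∀ᶠ z in nhds y, SmoothFieldAt (frameField e k) z := by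
    filter_upwards [he] with z hz using smoothFieldAt_frameField hz k
  have h1 := contMDiffAt_mvfderiv_apply
    (SmoothAlongAt.inner g (u := fun z : N => z) hY.self_of_nhds hs.self_of_nhds) hZ
  have h2 := SmoothAlongAt.inner g (u := fun z : N => z) (hD y Y Z hY hZ) hs.self_of_nhds
  have h3 := SmoothAlongAt.inner g (u := fun z : N => z) hY.self_of_nhds
    (hD y (frameField e k) Z hs hZ)
  refine ((h1.sub h2).sub h3).congr_of_eventuallyEq ?_
  filter_upwards [hY, hs] with z hz hsz
  rw [inner_conjugateForm, nablaMetric_apply g D hz.mdifferentiableAt hsz.mdifferentiableAt]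

/-- Used with `c = 1` for the conjugate connection and `c = 1/2` for the Levi-Civita connection. The
latter is known only through an existence statement, so its smoothness has to be drawn from that of
`∇`. -/
theorem smoothConnection_addOneForm_conjugateForm (g : Metric J N) {D : AffineConnection J N}
    (hD : SmoothConnection D) {D' : AffineConnection J N} (c : ℝ)
    (h : ∀ (z : N) (Y : Π z : N, TangentSpace J z) (w : TangentSpace J z), SmoothFieldAt Y z →
      D' Y z w = D Y z w + c • conjugateForm g D z (Y z) w) : SmoothConnection D' := by
  intro y Y Z hY hZ
  refine ContMDiffAt.congr_of_eventuallyEq ((hD y Y Z hY hZ).add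
    ((smoothFieldAt_conjugateForm g hD hY hZ).const_smul c)) ?_
  filter_upwards [hY] with z hz
  exact congrArg (fun w => (⟨z, w⟩ : TangentBundle J N)) (h z Y (Z z) hz)

end SmoothConnections

/-! ### The difference tensor `K` -/

section DifferenceTensor

section

variable {F : Type*} [NormedAddCommGroup F] [NormedSpace ℝ F]
  {G : Type*} [TopologicalSpace G] {J : ModelWithCorners ℝ F G}
  {N : Type*} [TopologicalSpace N] [ChartedSpace G N] [IsManifold J ∞ N]

theorem metric_add_left (g : Metric J N) (y : N) (v w z : TangentSpace J y) :
    g.inner y (v + w) z = g.inner y v z + g.inner y w z := by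
  rw [map_add, add_apply]

theorem metric_sub_left (g : Metric J N) (y : N) (v w z : TangentSpace J y) :
    g.inner y (v - w) z = g.inner y v z - g.inner y w z := by
  rw [map_sub, sub_apply]

theorem metric_smul_left (g : Metric J N) (y : N) (c : ℝ) (v z : TangentSpace J y) :
    g.inner y (c • v) z = c * g.inner y v z := by
  rw [map_smul, smul_apply, smul_eq_mul]

theorem metric_sum_left (g : Metric J N) (y : N) {ι : Type*} (s : Finset ι)
    (v : ι → TangentSpace J y) (z : TangentSpace J y) :
    g.inner y (∑ i ∈ s, v i) z = ∑ i ∈ s, g.inner y (v i) z := by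
  rw [map_sum, sum_apply]

end

variable {F : Type*} [NormedAddCommGroup F] [NormedSpace ℝ F] [FiniteDimensional ℝ F]
  {G : Type*} [TopologicalSpace G] {J : ModelWithCorners ℝ F G}
  {N : Type*} [TopologicalSpace N] [ChartedSpace G N] [IsManifold J ∞ N]

namespace StatGeom.StatisticalStructure

variable (T : StatisticalStructure J N)

theorem isLeviCivita : IsLeviCivita T.metric T.leviCivita := T.exists_leviCivita.choose_spec

theorem nabla_eq_add_K {y : N} {Z : Π z : N, TangentSpace J z} (hZ : MDiffAt (T% Z) y)
    (v : TangentSpace J y) : T.nabla Z y v = T.leviCivita Z y v + T.K y v (Z y) := by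
  have h := IsCovariantDerivativeOn.difference_apply T.nabla.isCovariantDerivativeOnUniv
    T.leviCivita.isCovariantDerivativeOnUniv (Set.mem_univ y) hZ
  have h2 : T.K y v (Z y) = (T.nabla Z y - T.leviCivita Z y) v :=
    congrArg (fun L : TangentSpace J y →L[ℝ] TangentSpace J y => L v) h
  rw [h2, sub_apply]
  abel

theorem K_symm (y : N) (v w : TangentSpace J y) : T.K y v w = T.K y w v := by
  have h1 := (CovariantDerivative.torsion_eq_zero_iff _).1 T.torsion_free
    (FiberBundle.mdifferentiableAt_extend J F v) (FiberBundle.mdifferentiableAt_extend J F w)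
  have h2 := (CovariantDerivative.torsion_eq_zero_iff _).1 T.isLeviCivita.1
    (FiberBundle.mdifferentiableAt_extend J F v) (FiberBundle.mdifferentiableAt_extend J F w)
  rw [T.nabla_eq_add_K (FiberBundle.mdifferentiableAt_extend ..),
    T.nabla_eq_add_K (FiberBundle.mdifferentiableAt_extend ..), ← h2] at h1
  simp only [FiberBundle.extend_apply_self] at h1
  rw [← sub_eq_zero] at h1 ⊢
  rw [← h1]
  abel

theorem isBilinearMap_K (y : N) :
    IsBilinearMap ℝ (fun v w : TangentSpace J y => T.K y v w) :=
  ⟨fun _ _ _ => by simp [K], fun _ _ _ => by simp [K], fun _ _ _ => by simp [K],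
    fun _ _ _ => by simp [K]⟩

theorem inner_K_add_inner_K (y : N) (v w z : TangentSpace J y) :
    T.metric.inner y (T.K y v w) z + T.metric.inner y w (T.K y v z)
      = - nablaMetric T.metric T.nabla y w z v := by
  have hw := FiberBundle.mdifferentiableAt_extend J F w
  have hz := FiberBundle.mdifferentiableAt_extend J F z
  have h1 := nablaMetric_apply T.metric T.nabla hw hz v
  have h2 := nablaMetric_apply T.metric T.leviCivita hw hz v
  rw [T.isLeviCivita.2, T.nabla_eq_add_K hw, T.nabla_eq_add_K hz] at *
  simp only [FiberBundle.extend_apply_self, map_add, add_apply, zero_apply] at h1 h2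
  rw [h1]
  linarith

/-- A Koszul-type argument: `K` is symmetric and, by Codazzi, `∇g` is totally symmetric, so the
three cyclic instances of `inner_K_add_inner_K` form a linear system with a single solution. -/
theorem inner_K (y : N) (v w z : TangentSpace J y) :
    T.metric.inner y (T.K y v w) z = - (1 / 2) * nablaMetric T.metric T.nabla y w z v := by
  have h (a b c) := T.inner_K_add_inner_K y a b c
  have hs (a b) := T.K_symm y a b
  have hN (a b c) := nablaMetric_symm T.metric T.nabla y a b c
  have hC (a b c) := T.codazzi y a b c
  have h1 := h v w z
  have h2 := h w z v
  have h3 := h z v w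
  rw [T.metric.symm y w] at h1
  rw [T.metric.symm y z] at h2
  rw [T.metric.symm y v] at h3
  rw [hs w v, hs w z] at *
  rw [hs z v] at *
  have e1 : nablaMetric T.metric T.nabla y z v w = nablaMetric T.metric T.nabla y w z v := by
    rw [hN z v w, hC w v z]
  have e2 : nablaMetric T.metric T.nabla y v w z = nablaMetric T.metric T.nabla y w z v := by
    rw [hC z v w, hN z w v]
  rw [e1] at h2
  rw [e2] at h3
  linarith

theorem inner_K_comm (y : N) (v w z : TangentSpace J y) :
    T.metric.inner y (T.K y v w) z = T.metric.inner y w (T.K y v z) := by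
  rw [T.metric.symm y w, T.inner_K, T.inner_K, nablaMetric_symm]

theorem eq_of_inner (g : Metric J N) {y : N} {v w : TangentSpace J y}
    (h : ∀ z, g.inner y v z = g.inner y w z) : v = w := by
  by_contra hne
  refine (g.pos y _ (sub_ne_zero.2 hne)).ne' ?_
  exact (metric_sub_left g y v w (v - w)).trans (sub_eq_zero.2 (h _))

theorem conjugateForm_eq (y : N) (v w : TangentSpace J y) :
    conjugateForm T.metric T.nabla y w v = (-2 : ℝ) • T.K y v w := by
  refine eq_of_inner T.metric fun z => ?_
  rw [inner_conjugateForm, map_smul, smul_apply, T.inner_K, smul_eq_mul]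
  ring

theorem nablaBar_eq (Z : Π z : N, TangentSpace J z) (y : N) (v : TangentSpace J y) :
    T.nablaBar Z y v = T.nabla Z y v - (2 : ℝ) • T.K y v (Z y) := by
  have : T.nablaBar Z y v = T.nabla Z y v + conjugateForm T.metric T.nabla y (Z y) v := rfl
  rw [this, T.conjugateForm_eq, neg_smul]
  abel

theorem nablaBar_eq_sub_K {y : N} {Z : Π z : N, TangentSpace J z} (hZ : MDiffAt (T% Z) y)
    (v : TangentSpace J y) : T.nablaBar Z y v = T.leviCivita Z y v - T.K y v (Z y) := by
  rw [T.nablaBar_eq, T.nabla_eq_add_K hZ, two_smul]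
  abel

variable [T2Space N]

theorem smoothConnection_nabla : SmoothConnection T.nabla := smoothConnection_of_contMDiff T.smooth

theorem smoothConnection_nablaBar : SmoothConnection T.nablaBar :=
  smoothConnection_addOneForm_conjugateForm T.metric T.smoothConnection_nabla 1
    fun _ _ _ _ => by rw [one_smul]; rfl

theorem smoothConnection_leviCivita : SmoothConnection T.leviCivita :=
  smoothConnection_addOneForm_conjugateForm T.metric T.smoothConnection_nabla (1 / 2)
    fun z Y w hY => by
      rw [T.nabla_eq_add_K hY.mdifferentiableAt, T.conjugateForm_eq, smul_smul]
      norm_num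

theorem smoothFieldAt_K {y : N} {Y Z : Π z : N, TangentSpace J z}
    (hY : ∀ᶠ z in nhds y, SmoothFieldAt Y z) (hZ : SmoothFieldAt Z y) :
    SmoothFieldAt (fun z => T.K z (Z z) (Y z)) y := by
  have h := (smoothFieldAt_conjugateForm T.metric T.smoothConnection_nabla hY hZ).const_smul
    (- (1 / 2))
  convert h using 2 with z
  rw [Pi.smul_apply, T.conjugateForm_eq, smul_smul]
  norm_num

end StatGeom.StatisticalStructure

end DifferenceTensor

/-! ### Smooth fields and conjugate connections along a map -/

section Along

variable {E : Type*} [NormedAddCommGroup E] [NormedSpace ℝ E]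
  {H : Type*} [TopologicalSpace H] {I : ModelWithCorners ℝ E H}
  {M : Type*} [TopologicalSpace M] [ChartedSpace H M]
  {F : Type*} [NormedAddCommGroup F] [NormedSpace ℝ F] [FiniteDimensional ℝ F]
  {G : Type*} [TopologicalSpace G] {J : ModelWithCorners ℝ F G}
  {N : Type*} [TopologicalSpace N] [ChartedSpace G N] [IsManifold J ∞ N]

namespace SmoothAlongAt

variable {u : M → N} {σ ρ : Π x : M, TangentSpace J (u x)} {x : M}

theorem eventually_mem_baseSet (hu : ContMDiffAt I J ∞ u x) :
    ∀ᶠ y in nhds x, u y ∈ (trivializationAt F (TangentSpace J) (u x)).baseSet :=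
  hu.continuousAt.preimage_mem_nhds ((trivializationAt F (TangentSpace J) (u x)).open_baseSet.mem_nhds
    (FiberBundle.mem_baseSet_trivializationAt' (u x)))

theorem add (hσ : SmoothAlongAt I u σ x) (hρ : SmoothAlongAt I u ρ x) :
    SmoothAlongAt I u (fun y => σ y + ρ y) x := by
  have hx := FiberBundle.mem_baseSet_trivializationAt' (F := F) (E := (TangentSpace J)) (u x)
  refine (smoothAlongAt_iff hx).2 ⟨hσ.base, fun k => ?_⟩
  refine ContMDiffAt.congr_of_eventuallyEq ((((smoothAlongAt_iff hx).1 hσ).2 k).add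
    (((smoothAlongAt_iff hx).1 hρ).2 k)) ?_
  filter_upwards [eventually_mem_baseSet hσ.base] with y hy using frameCoeff_add hy _ _ _

theorem smul {f : M → ℝ} (hf : ContMDiffAt I 𝓘(ℝ) ∞ f x) (hσ : SmoothAlongAt I u σ x) :
    SmoothAlongAt I u (fun y => f y • σ y) x := by
  have hx := FiberBundle.mem_baseSet_trivializationAt' (F := F) (E := (TangentSpace J)) (u x)
  refine (smoothAlongAt_iff hx).2 ⟨hσ.base, fun k => ?_⟩
  refine ContMDiffAt.congr_of_eventuallyEq (hf.mul (((smoothAlongAt_iff hx).1 hσ).2 k)) ?_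
  filter_upwards [eventually_mem_baseSet hσ.base] with y hy using frameCoeff_smul hy _ _ _

theorem sub (hσ : SmoothAlongAt I u σ x) (hρ : SmoothAlongAt I u ρ x) :
    SmoothAlongAt I u (fun y => σ y - ρ y) x := by
  convert hσ.add (hρ.smul (f := fun _ => -1) contMDiffAt_const) using 2 with y
  rw [neg_one_smul, sub_eq_add_neg]

theorem sum (hu : ContMDiffAt I J ∞ u x) {ι : Type*} (s : Finset ι)
    {σ : ι → Π x : M, TangentSpace J (u x)} (hσ : ∀ i ∈ s, SmoothAlongAt I u (σ i) x) :
    SmoothAlongAt I u (fun y => ∑ i ∈ s, σ i y) x := by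
  classical
  induction s using Finset.induction_on with
  | empty =>
    simpa using! (contMDiff_zeroSection ℝ (TangentSpace J : N → Type _)).contMDiffAt.comp x hu
  | insert i s hi ih =>
    simp only [Finset.mem_insert, forall_eq_or_imp] at hσ
    simp only [Finset.sum_insert hi]
    exact hσ.1.add (ih hσ.2)

theorem congr (hσ : SmoothAlongAt I u σ x) (h : ∀ᶠ y in nhds x, ρ y = σ y) :
    SmoothAlongAt I u ρ x := by
  refine ContMDiffAt.congr_of_eventuallyEq hσ ?_
  filter_upwards [h] with y hy
  rw [hy]

theorem comp {Y : Π z : N, TangentSpace J z} (hu : ContMDiffAt I J ∞ u x)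
    (hY : SmoothFieldAt Y (u x)) : SmoothAlongAt I u (fun y => Y (u y)) x :=
  ContMDiffAt.comp x hY hu

variable [IsManifold I ∞ M]

/-- The induced connection preserves smoothness. -/
theorem pullback {D : AffineConnection J N} (hD : SmoothConnection D)
    (hσ : ∀ᶠ y in nhds x, SmoothAlongAt I u σ y) {X : Π x : M, TangentSpace I x}
    (hX : SmoothAlongAt I (fun y : M => y) X x) :
    SmoothAlongAt I u (fun y => StatGeom.pullback D u σ y (X y)) x := by
  have hu := hσ.self_of_nhds.base
  let e := trivializationAt F (fun y : N => TangentSpace J y) (u x)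
  have hx : u x ∈ e.baseSet := FiberBundle.mem_baseSet_trivializationAt' (u x)
  have he : ∀ᶠ y in nhds x, u y ∈ e.baseSet := eventually_mem_baseSet hu
  have hs (k) : ∀ᶠ z in nhds (u x), SmoothFieldAt (frameField e k) z := by
    filter_upwards [e.open_baseSet.mem_nhds hx] with z hz using smoothFieldAt_frameField hz k
  have hw := (smoothAlongAt_iff hx).1 (smoothAlongAt_pushforward hu hX)
  have hDs (k l) : SmoothAlongAt I u
      (fun y => D (frameField e k) (u y) (frameField e l (u y))) x :=
    comp (Y := fun z => D (frameField e k) z (frameField e l z)) hu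
      (hD (u x) _ _ (hs k) (hs l).self_of_nhds)
  have hσx := (smoothAlongAt_iff hx).1 hσ.self_of_nhds
  -- Expanding `u_* X` as well means that `D` is only applied to frame fields in frame directions,
  -- so every factor is a smooth function or a smooth field of `N` composed with `u`.
  have hmain : SmoothAlongAt I u (fun y => ∑ k,
      (mvfderiv I (fun y => frameCoeff e k (u y) (σ y)) y (X y) • frameField e k (u y)
        + frameCoeff e k (u y) (σ y) • ∑ l, frameCoeff e l (u y) (pushforward I J u X y) •
          D (frameField e k) (u y) (frameField e l (u y)))) x :=
    sum hu _ fun k _ => (smul (contMDiffAt_mvfderiv_apply (hσx.2 k) hX)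
      (comp hu (hs k).self_of_nhds)).add (smul (hσx.2 k)
        (sum hu _ fun l _ => smul (hw.2 l) (hDs k l)))
  refine hmain.congr ?_
  filter_upwards [he, hσ] with y hy hσy
  rw [pullback_eq_sum D hy hσy]
  refine Finset.sum_congr rfl fun k _ => ?_
  have := congrArg (D (frameField e k) (u y)) (sum_frameCoeff hy (pushforward I J u X y))
  rw [map_sum] at this
  simp only [map_smul] at this
  rw [this]
  rfl

end SmoothAlongAt

theorem pullback_nabla (T : StatisticalStructure J N) {u : M → N}
    (σ : Π x : M, TangentSpace J (u x)) (x : M) (v : TangentSpace I x) :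
    pullback T.nabla u σ x v
      = pullback T.leviCivita u σ x v + T.K (u x) (mfderiv I J u x v) (σ x) := by
  simp only [pullback, add_apply, ContinuousLinearMap.comp_apply]
  rw [T.nabla_eq_add_K (FiberBundle.mdifferentiableAt_extend ..), FiberBundle.extend_apply_self]
  abel

theorem pullback_nablaBar (T : StatisticalStructure J N) {u : M → N}
    (σ : Π x : M, TangentSpace J (u x)) (x : M) (v : TangentSpace I x) :
    pullback T.nablaBar u σ x v
      = pullback T.leviCivita u σ x v - T.K (u x) (mfderiv I J u x v) (σ x) := by
  simp only [pullback, add_apply, ContinuousLinearMap.comp_apply]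
  rw [T.nablaBar_eq_sub_K (FiberBundle.mdifferentiableAt_extend ..),
    FiberBundle.extend_apply_self]
  abel

/-- The product rule for a pair of conjugate connections along a map. -/
theorem mvfderiv_inner_conjugate (T : StatisticalStructure J N) {u : M → N}
    {σ ρ : Π x : M, TangentSpace J (u x)} {x : M} (hσ : SmoothAlongAt I u σ x)
    (hρ : SmoothAlongAt I u ρ x) (v : TangentSpace I x) :
    mvfderiv I (fun y => T.metric.inner (u y) (σ y) (ρ y)) x v
      = T.metric.inner (u x) (pullback T.nablaBar u σ x v) (ρ x)
        + T.metric.inner (u x) (σ x) (pullback T.nabla u ρ x v) := by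
  -- The Levi-Civita connection has no defect term, and the two `K` terms have opposite signs and
  -- cancel because `K` is self-adjoint.
  rw [mvfderiv_inner_along T.metric T.leviCivita hσ hρ, T.isLeviCivita.2, pullback_nabla,
    pullback_nablaBar, map_add, metric_sub_left, T.inner_K_comm]
  simp only [zero_apply]
  ring

end Along

/-! ### Second fundamental form and smoothness of the tension field -/

section SecondFundamentalForm

variable {E : Type*} [NormedAddCommGroup E] [NormedSpace ℝ E] [FiniteDimensional ℝ E]
  {H : Type*} [TopologicalSpace H] {I : ModelWithCorners ℝ E H}
  {M : Type*} [TopologicalSpace M] [ChartedSpace H M] [IsManifold I ∞ M]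
  {F : Type*} [NormedAddCommGroup F] [NormedSpace ℝ F] [FiniteDimensional ℝ F]
  {G : Type*} [TopologicalSpace G] {J : ModelWithCorners ℝ F G}
  {N : Type*} [TopologicalSpace N] [ChartedSpace G N] [IsManifold J ∞ N]

/-- For `f Y`, both terms produce the same derivative term `df(v) u_* Y`, and it cancels in the
difference. -/
theorem tensorialAt_secondFundamentalForm (DM : AffineConnection I M) (DN : AffineConnection J N)
    {u : M → N} {x : M} (hu : ContMDiffAt I J ∞ u x) (v : TangentSpace I x) :
    TensorialAt I E (fun Y => pullback DN u (pushforward I J u Y) x v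
      - mfderiv I J u x (DM Y x v)) x where
  smul {f Y} hf hY := by
    have h : pushforward I J u (f • Y) = fun y => f y • pushforward I J u Y y := by
      funext y
      simp [pushforward]
    rw [h, pullback_smul DN hf (mdifferentiableAt_pushforward hu hY),
      DM.isCovariantDerivativeOn.leibniz hY hf]
    simp only [add_apply, smul_apply, ContinuousLinearMap.smulRight_apply, map_add, map_smul,
      smul_sub, pushforward]
    abel
  add {Y Y'} hY hY' := by
    have h : pushforward I J u (Y + Y') = pushforward I J u Y + pushforward I J u Y' := by
      funext y
      simp [pushforward]
    rw [h, pullback_add DN (mdifferentiableAt_pushforward hu hY)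
      (mdifferentiableAt_pushforward hu hY'), DM.isCovariantDerivativeOn.add hY hY']
    simp only [add_apply, map_add]
    abel

/-- The second fundamental form `(∇u_*)(v, w)` of the map `u`. -/
def secondFundamentalForm (DM : AffineConnection I M) (DN : AffineConnection J N) (u : M → N)
    (x : M) (v w : TangentSpace I x) : TangentSpace J (u x) :=
  pullback DN u (pushforward I J u (FiberBundle.extend E w)) x v
    - mfderiv I J u x (DM (FiberBundle.extend E w) x v)

theorem secondFundamentalForm_apply (DM : AffineConnection I M) (DN : AffineConnection J N)
    {u : M → N} {x : M} (hu : ContMDiffAt I J ∞ u x) {Y : Π x : M, TangentSpace I x}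
    (hY : MDiffAt (T% Y) x) (v : TangentSpace I x) :
    secondFundamentalForm DM DN u x v (Y x)
      = pullback DN u (pushforward I J u Y) x v - mfderiv I J u x (DM Y x v) :=
  (tensorialAt_secondFundamentalForm DM DN hu v).mkHom_apply hY

theorem isBilinearMap_secondFundamentalForm (DM : AffineConnection I M)
    (DN : AffineConnection J N) {u : M → N} {x : M} (hu : ContMDiffAt I J ∞ u x) :
    IsBilinearMap ℝ (secondFundamentalForm DM DN u x) := by
  have h (v w : TangentSpace I x) : secondFundamentalForm DM DN u x v w
    = TensorialAt.mkHom _ x (tensorialAt_secondFundamentalForm DM DN hu v) w := rfl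
  refine ⟨fun a b w => ?_, fun c a w => ?_, fun v a b => ?_, fun c v a => ?_⟩
  · simp only [secondFundamentalForm, map_add]
    abel
  · simp only [secondFundamentalForm, map_smul, smul_sub]
  · simp only [h, map_add]
  · simp only [h, map_smul]

variable (e : Trivialization E (TotalSpace.proj : TotalSpace E (TangentSpace I : M → Type _) → M))
  [MemTrivializationAtlas e]

/-- The local frame dual to `frameField e` with respect to the metric `g`. -/
def dualFrameField (g : Metric I M) (k : Fin (Module.finrank ℝ E)) (x : M) : TangentSpace I x :=
  sharp g x (frameCoeff e k x)

variable {e}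

theorem smoothFieldAt_dualFrameField (g : Metric I M) {x : M} (hx : x ∈ e.baseSet) (k) :
    SmoothFieldAt (dualFrameField e g k) x := by
  refine smoothFieldAt_of_inner g hx fun l => ?_
  -- By duality the inner products with the frame fields are locally constant.
  refine (contMDiffAt_const (c := if k = l then (1 : ℝ) else 0)).congr_of_eventuallyEq ?_
  filter_upwards [e.open_baseSet.mem_nhds hx] with y hy
  let φ : TangentSpace I y →ₗ[ℝ] ℝ :=
    { toFun := frameCoeff e k y
      map_add' := frameCoeff_add hy k
      map_smul' := frameCoeff_smul hy k }
  exact (inner_sharp g y φ _).trans (frameCoeff_frameField hy k l)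

/-- The orthonormal basis `frame` is chosen at each point separately and need not vary smoothly.
Rewriting the trace with a smooth frame and its metric dual gives a formula that can be
differentiated. -/
theorem tension_eq_sum (g : Metric I M) (DM : AffineConnection I M) (DN : AffineConnection J N)
    {u : M → N} {x : M} (hu : ContMDiffAt I J ∞ u x) (hx : x ∈ e.baseSet) :
    tension g DM DN u x = ∑ k, (pullback DN u (pushforward I J u (frameField e k)) x
        (dualFrameField e g k x)
      - mfderiv I J u x (DM (frameField e k) x (dualFrameField e g k x))) := by
  have hB := isBilinearMap_secondFundamentalForm DM DN hu
  have h1 (v w : TangentSpace I x) : secondFundamentalForm DM DN u x v w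
      = ∑ k, secondFundamentalForm DM DN u x (frameCoeff e k x w • v) (frameField e k x) := by
    have := map_sum (hB.toLinearMap v) (fun k => frameCoeff e k x w • frameField e k x) Finset.univ
    rw [sum_frameCoeff hx w] at this
    refine this.trans (Finset.sum_congr rfl fun k _ => ?_)
    exact (hB.smul_right _ _ _).trans (hB.smul_left _ _ _).symm
  change ∑ i, secondFundamentalForm DM DN u x (frame g x i) (frame g x i) = _
  simp only [h1 (frame g x _) (frame g x _)]
  rw [Finset.sum_comm]
  refine Finset.sum_congr rfl fun k _ => ?_
  rw [← secondFundamentalForm_apply DM DN hu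
    (smoothFieldAt_frameField hx k).mdifferentiableAt]
  have := map_sum (hB.toLinearMap.flip (frameField e k x))
    (fun i => frameCoeff e k x (frame g x i) • frame g x i) Finset.univ
  exact this.symm

theorem smoothAlongAt_tension (g : Metric I M) {DM : AffineConnection I M}
    {DN : AffineConnection J N} (hM : SmoothConnection DM) (hN : SmoothConnection DN)
    {u : M → N} (hu : ContMDiff I J ∞ u) (x : M) :
    SmoothAlongAt I u (tension g DM DN u) x := by
  let e := trivializationAt E (fun y : M => TangentSpace I y) x
  have hx : x ∈ e.baseSet := FiberBundle.mem_baseSet_trivializationAt' x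
  have hs (k) : ∀ᶠ y in nhds x, SmoothFieldAt (frameField e k) y := by
    filter_upwards [e.open_baseSet.mem_nhds hx] with y hy using smoothFieldAt_frameField hy k
  have hd (k) := smoothFieldAt_dualFrameField g hx k
  refine SmoothAlongAt.congr (SmoothAlongAt.sum hu.contMDiffAt Finset.univ fun k _ =>
    (SmoothAlongAt.pullback hN (σ := pushforward I J u (frameField e k)) ?_ (hd k)).sub
      (smoothAlongAt_pushforward hu.contMDiffAt (hM x _ _ (hs k) (hd k)))) ?_
  · filter_upwards [hs k] with y hy using smoothAlongAt_pushforward hu.contMDiffAt hy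
  · filter_upwards [e.open_baseSet.mem_nhds hx] with y hy
    exact tension_eq_sum g DM DN hu.contMDiffAt hy

end SecondFundamentalForm

/-! ### Coordinate fields commute -/

section CoordinateFields

variable {F : Type*} [NormedAddCommGroup F] [NormedSpace ℝ F] [FiniteDimensional ℝ F]
  {G : Type*} [TopologicalSpace G] {J : ModelWithCorners ℝ F G}
  {N : Type*} [TopologicalSpace N] [ChartedSpace G N] [IsManifold J ∞ N]

theorem constField_trivializationAt {y z : N} (hz : z ∈ (chartAt G y).source) (b : F) :
    constField (trivializationAt F (TangentSpace J) y) b z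
      = mfderivWithin 𝓘(ℝ, F) J (extChartAt J y).symm (Set.range J) (extChartAt J y z) b := by
  rw [constField, TangentBundle.symmL_trivializationAt hz]
  rfl

/-- In the chart centred at `y` these are coordinate fields: they pull back to constant fields. The
bracket term in the definition of the curvature thus drops out. -/
theorem mlieBracket_constField (y : N) (a b : F) :
    VectorField.mlieBracket J (constField (trivializationAt F (TangentSpace J) y) a)
      (constField (trivializationAt F (TangentSpace J) y) b) y = 0 := by
  have hc (a : F) : VectorField.mpullbackWithin 𝓘(ℝ, F) J (extChartAt J y).symm
      (constField (trivializationAt F (TangentSpace J) y) a) (Set.range J)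
      =ᶠ[nhdsWithin (extChartAt J y y) (Set.range J)] fun _ => a := by
    filter_upwards [extChartAt_target_mem_nhdsWithin (I := J) y] with p hp
    have hz : (extChartAt J y).symm p ∈ (chartAt G y).source := by
      rw [← extChartAt_source J]
      exact (extChartAt J y).map_target hp
    rw [VectorField.mpullbackWithin_apply, constField_trivializationAt hz,
      (extChartAt J y).right_inv hp]
    have hinv := isInvertible_mfderivWithin_extChartAt_symm (I := J) hp
    exact hinv.inverse_apply_eq.2 rfl
  rw [← VectorField.mlieBracketWithin_univ, VectorField.mlieBracketWithin_apply]
  rw [Set.preimage_univ, Set.univ_inter,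
    Filter.EventuallyEq.lieBracketWithin_vectorField_eq_of_mem (hc a) (hc b) (Set.mem_range_self _)]
  have h0 : VectorField.lieBracketWithin ℝ (fun _ : F => a) (fun _ => b) (Set.range J)
      (extChartAt J y y) = 0 := by
    simp [VectorField.lieBracketWithin]
  rw [h0]
  exact map_zero _

theorem mlieBracket_extend {y : N} (v w : TangentSpace J y) :
    VectorField.mlieBracket J (FiberBundle.extend F v) (FiberBundle.extend F w) y = 0 := by
  rw [Filter.EventuallyEq.mlieBracket_vectorField_eq (eventuallyEq_extend y v)
    (eventuallyEq_extend y w), mlieBracket_constField]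

theorem eventually_smoothFieldAt_extend {y : N} (v : TangentSpace J y) :
    ∀ᶠ z in nhds y, SmoothFieldAt (FiberBundle.extend F v : Π z : N, TangentSpace J z) z := by
  have hy := FiberBundle.mem_baseSet_trivializationAt' (F := F) (E := (TangentSpace J)) y
  filter_upwards [(eventuallyEq_extend y v).eventually_nhds,
    (trivializationAt F (TangentSpace J) y).open_baseSet.mem_nhds hy] with z hz hz'
  exact SmoothAlongAt.congr (contMDiffAt_constField hz' _) hz

variable [J.Boundaryless]

theorem mvfderiv_constField {f : N → ℝ} {y z : N} (hz : z ∈ (chartAt G y).source)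
    (hf : MDiffAt f z) (b : F) :
    mvfderiv J f z (constField (trivializationAt F (TangentSpace J) y) b z)
      = fderiv ℝ (f ∘ (extChartAt J y).symm) (extChartAt J y z) b := by
  have hz' : z ∈ (extChartAt J y).source := by rwa [extChartAt_source]
  have hs : MDiffAt (extChartAt J y).symm (extChartAt J y z) := by
    have := mdifferentiableWithinAt_extChartAt_symm ((extChartAt J y).map_source hz')
    rwa [J.range_eq_univ, mdifferentiableWithinAt_univ] at this
  -- The chart only returns to `z` up to a propositional equality, and the tangent space depends on
  -- the point; a free `z'` lets the equality be substituted.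
  have aux (z' : N) (h : (extChartAt J y).symm (extChartAt J y z) = z') (hf : MDiffAt f z') :
      mvfderiv J f z' (mfderiv 𝓘(ℝ, F) J (extChartAt J y).symm (extChartAt J y z) b :)
        = fderiv ℝ (f ∘ (extChartAt J y).symm) (extChartAt J y z) b := by
    subst h
    rw [← mfderiv_eq_fderiv]
    exact (congrArg (fun L => L b) (mvfderiv_comp_map hf hs)).symm
  rw [constField_trivializationAt hz, J.range_eq_univ, mfderivWithin_univ]
  exact aux z ((extChartAt J y).left_inv hz') hf

/-- Both sides are the second derivative of `f` read in the chart, which is symmetric. -/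
theorem mvfderiv_mvfderiv_constField {f : N → ℝ} {y : N} (hf : ∀ᶠ z in nhds y, ContMDiffAt J 𝓘(ℝ) ∞ f z)
    (a b : F) :
    mvfderiv J (fun z => mvfderiv J f z (constField (trivializationAt F (TangentSpace J) y) b z)) y
        (constField (trivializationAt F (TangentSpace J) y) a y)
      = mvfderiv J (fun z =>
          mvfderiv J f z (constField (trivializationAt F (TangentSpace J) y) a z)) y
        (constField (trivializationAt F (TangentSpace J) y) b y) := by
  set φ := extChartAt J y with hφ
  have hy := mem_chart_source G y
  have hC : ContDiffAt ℝ 2 (f ∘ φ.symm) (φ y) := by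
    have := (contMDiffAt_iff.1 (ContMDiffAt.of_le (m := 2) hf.self_of_nhds ENat.LEInfty.out)).2
    rw [J.range_eq_univ, contDiffWithinAt_univ] at this
    exact this
  have hd : DifferentiableAt ℝ (fderiv ℝ (f ∘ φ.symm)) (φ y) :=
    (hC.fderiv_right (m := 1) (by norm_num)).differentiableAt (by simp)
  have key (a b : F) : mvfderiv J (fun z =>
        mvfderiv J f z (constField (trivializationAt F (TangentSpace J) y) b z)) y
        (constField (trivializationAt F (TangentSpace J) y) a y)
      = fderiv ℝ (fderiv ℝ (f ∘ φ.symm)) (φ y) a b := by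
    have hev : (fun z => mvfderiv J f z (constField (trivializationAt F (TangentSpace J) y) b z))
        =ᶠ[nhds y] fun z => fderiv ℝ (f ∘ φ.symm) (φ z) b := by
      filter_upwards [(chartAt G y).open_source.mem_nhds hy, hf] with z hz hfz
      exact mvfderiv_constField hz (hfz.mdifferentiableAt (by simp)) b
    have hdb : DifferentiableAt ℝ (fun p => fderiv ℝ (f ∘ φ.symm) p b) (φ y) :=
      hd.clm_apply (differentiableAt_const b)
    have hm : MDiffAt (fun z => fderiv ℝ (f ∘ φ.symm) (φ z) b) y :=
      hdb.mdifferentiableAt.comp y (mdifferentiableAt_extChartAt hy)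
    rw [hev.mvfderiv_eq, mvfderiv_constField hy hm]
    have hev2 : ((fun z => fderiv ℝ (f ∘ φ.symm) (φ z) b) ∘ φ.symm)
        =ᶠ[nhds (φ y)] fun p => fderiv ℝ (f ∘ φ.symm) p b := by
      filter_upwards [extChartAt_target_mem_nhds (I := J) y] with p hp
      simp only [Function.comp_apply]
      rw [φ.right_inv hp]
    rw [hev2.fderiv_eq, fderiv_clm_apply hd (differentiableAt_const b)]
    simp
  rw [key, key]
  exact (hC.isSymmSndFDerivAt (by simp)).eq a b

theorem mvfderiv_mvfderiv_extend {f : N → ℝ} {y : N} (hf : ∀ᶠ z in nhds y, ContMDiffAt J 𝓘(ℝ) ∞ f z)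
    (v w : TangentSpace J y) :
    mvfderiv J (fun z => mvfderiv J f z (FiberBundle.extend F w z)) y v
      = mvfderiv J (fun z => mvfderiv J f z (FiberBundle.extend F v z)) y w := by
  have hy := FiberBundle.mem_baseSet_trivializationAt' (F := F) (E := (TangentSpace J)) y
  have hev (w : TangentSpace J y) : (fun z => mvfderiv J f z (FiberBundle.extend F w z))
      =ᶠ[nhds y] fun z => mvfderiv J f z (constField (trivializationAt F (TangentSpace J) y)
        (trivializationAt F (TangentSpace J) y ⟨y, w⟩).2 z) := by
    filter_upwards [eventuallyEq_extend y w] with z hz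
    rw [hz]
  have h := mvfderiv_mvfderiv_constField hf (trivializationAt F (TangentSpace J) y ⟨y, v⟩).2
    (trivializationAt F (TangentSpace J) y ⟨y, w⟩).2
  rw [constField_snd hy, constField_snd hy] at h
  rw [(hev w).mvfderiv_eq, (hev v).mvfderiv_eq, h]

end CoordinateFields

/-! ### Curvatures of conjugate connections -/

section Curvature

variable {F : Type*} [NormedAddCommGroup F] [NormedSpace ℝ F] [FiniteDimensional ℝ F]
  {G : Type*} [TopologicalSpace G] {J : ModelWithCorners ℝ F G}
  {N : Type*} [TopologicalSpace N] [ChartedSpace G N] [IsManifold J ∞ N]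

theorem curvature_eq (D : AffineConnection J N) (y : N) (v w z : TangentSpace J y) :
    curvature D y v w z
      = D (fun p => D (FiberBundle.extend F z) p (FiberBundle.extend F w p)) y v
        - D (fun p => D (FiberBundle.extend F z) p (FiberBundle.extend F v p)) y w := by
  simp only [curvature, mlieBracket_extend, map_zero, sub_zero, FiberBundle.extend_apply_self]

theorem curvature_self (D : AffineConnection J N) (y : N) (v z : TangentSpace J y) :
    curvature D y v v z = 0 := by
  rw [curvature_eq, sub_self]

theorem curvature_swap (D : AffineConnection J N) (y : N) (v w z : TangentSpace J y) :
    curvature D y v w z = - curvature D y w v z := by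
  rw [curvature_eq, curvature_eq, neg_sub]

theorem SmoothConnection.smoothFieldAt_extend {D : AffineConnection J N} (hD : SmoothConnection D)
    {y : N} (z w : TangentSpace J y) :
    ∀ᶠ p in nhds y, SmoothFieldAt
      (fun p => D (FiberBundle.extend F z) p (FiberBundle.extend F w p)) p := by
  filter_upwards [(eventually_smoothFieldAt_extend z).eventually_nhds,
    eventually_smoothFieldAt_extend w] with p hz hw using hD p _ _ hz hw

/-- Linearity in this slot, with antisymmetry in the first two, is all that the traces and the
tensor `L` require. -/
theorem isLinearMap_curvature {D : AffineConnection J N} (hD : SmoothConnection D) (y : N)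
    (w z : TangentSpace J y) : IsLinearMap ℝ (fun v => curvature D y v w z) where
  map_add v v' := by
    have h (a : TangentSpace J y) := (hD.smoothFieldAt_extend z a).self_of_nhds.mdifferentiableAt
    have h1 : D (fun p => D (FiberBundle.extend F z) p (FiberBundle.extend F (v + v') p)) y
        = D (fun p => D (FiberBundle.extend F z) p (FiberBundle.extend F v p)) y
          + D (fun p => D (FiberBundle.extend F z) p (FiberBundle.extend F v' p)) y := by
      rw [← D.isCovariantDerivativeOn.add (h v) (h v')]
      refine connection_congr D (h _) (mdifferentiableAt_add_section (h v) (h v')) ?_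
      filter_upwards [eventually_extend_add v v'] with p hp
      rw [hp, Pi.add_apply, map_add]
      rfl
    rw [curvature_eq, curvature_eq, curvature_eq, h1, map_add, add_apply]
    abel
  map_smul c v := by
    have h (a : TangentSpace J y) := (hD.smoothFieldAt_extend z a).self_of_nhds.mdifferentiableAt
    have h1 : D (fun p => D (FiberBundle.extend F z) p (FiberBundle.extend F (c • v) p)) y
        = c • D (fun p => D (FiberBundle.extend F z) p (FiberBundle.extend F v p)) y := by
      rw [← D.isCovariantDerivativeOn.smul_const c (h v)]
      refine connection_congr D (h _) (mdifferentiableAt_const.smul_section (h v)) ?_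
      filter_upwards [eventually_extend_smul c v] with p hp
      rw [hp, Pi.smul_apply, map_smul]
      rfl
    rw [curvature_eq, curvature_eq, h1, map_smul, smul_apply, smul_sub]

namespace StatGeom.StatisticalStructure

variable [T2Space N] (T : StatisticalStructure J N)

/-- With `∇ = ∇^h + K` and `∇̄ = ∇^h - K`, the terms linear in `K` cancel in `∇∇ + ∇̄∇̄`, so no
derivative of `K` remains. -/
theorem curvature_add_curvature_nablaBar (y : N) (v w z : TangentSpace J y) :
    curvature T.nabla y v w z + curvature T.nablaBar y v w z
      = (2 : ℝ) • (curvature T.leviCivita y v w z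
        + (T.K y v (T.K y w z) - T.K y w (T.K y v z))) := by
  have hB := T.isBilinearMap_K y
  have hL (w) := (T.smoothConnection_leviCivita.smoothFieldAt_extend z w).self_of_nhds
  have hK (w : TangentSpace J y) : SmoothFieldAt
      (fun p => T.K p (FiberBundle.extend F w p) (FiberBundle.extend F z p)) y :=
    T.smoothFieldAt_K (eventually_smoothFieldAt_extend z)
      (eventually_smoothFieldAt_extend w).self_of_nhds
  have key (v w : TangentSpace J y) :
      T.nabla (fun p => T.nabla (FiberBundle.extend F z) p (FiberBundle.extend F w p)) y v
        + T.nablaBar (fun p => T.nablaBar (FiberBundle.extend F z) p (FiberBundle.extend F w p)) y v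
      = (2 : ℝ) • (T.leviCivita (fun p => T.leviCivita (FiberBundle.extend F z) p
        (FiberBundle.extend F w p)) y v + T.K y v (T.K y w z)) := by
    have hev : ∀ᶠ p in nhds y, MDiffAt (T% (FiberBundle.extend F z)) p := by
      filter_upwards [eventually_smoothFieldAt_extend z] with p hp using hp.mdifferentiableAt
    have h1 := connection_congr T.nabla
      (T.smoothConnection_nabla.smoothFieldAt_extend z w).self_of_nhds.mdifferentiableAt
      ((hL w).add (hK w)).mdifferentiableAt
      (by filter_upwards [hev] with p hp using T.nabla_eq_add_K hp _)
    have h2 := connection_congr T.nablaBar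
      (T.smoothConnection_nablaBar.smoothFieldAt_extend z w).self_of_nhds.mdifferentiableAt
      ((hL w).add ((hK w).const_smul (-1))).mdifferentiableAt
      (by
        filter_upwards [hev] with p hp
        rw [T.nablaBar_eq_sub_K hp, sub_eq_add_neg, ← neg_one_smul ℝ]
        rfl)
    rw [h1, h2, T.nabla_eq_add_K ((hL w).add (hK w)).mdifferentiableAt,
      T.nablaBar_eq_sub_K ((hL w).add ((hK w).const_smul (-1))).mdifferentiableAt,
      T.leviCivita.isCovariantDerivativeOn.add (hL w).mdifferentiableAt (hK w).mdifferentiableAt,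
      T.leviCivita.isCovariantDerivativeOn.add (hL w).mdifferentiableAt
        ((hK w).const_smul (-1)).mdifferentiableAt,
      T.leviCivita.isCovariantDerivativeOn.smul_const _ (hK w).mdifferentiableAt]
    simp only [Pi.add_apply, Pi.smul_apply, FiberBundle.extend_apply_self, hB.add_right,
      hB.smul_right, add_apply, smul_apply]
    module
  have e1 := key v w
  have e2 := key w v
  rw [curvature_eq, curvature_eq, curvature_eq]
  rw [sub_add_sub_comm, e1, e2, ← smul_sub]
  congr 1
  abel

/-- Differentiate `h(Z, T)` twice with the conjugate product rule. Second derivatives along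
commuting fields agree, and the mixed terms `h(∇Z, ∇̄T)` are symmetric in the two directions, which
leaves the two curvatures. -/
theorem inner_curvature_nabla [J.Boundaryless] (y : N) (v w z t : TangentSpace J y) :
    T.metric.inner y (curvature T.nabla y v w z) t
      = - T.metric.inner y z (curvature T.nablaBar y v w t) := by
  have hz := eventually_smoothFieldAt_extend z
  have ht := eventually_smoothFieldAt_extend t
  have hf : ∀ᶠ p in nhds y, ContMDiffAt J 𝓘(ℝ) ∞
      (fun p => T.metric.inner p (FiberBundle.extend F z p) (FiberBundle.extend F t p)) p := by
    filter_upwards [hz, ht] with p hz ht using SmoothAlongAt.inner T.metric hz ht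
  have key (v w : TangentSpace J y) : mvfderiv J (fun p => mvfderiv J (fun p =>
        T.metric.inner p (FiberBundle.extend F z p) (FiberBundle.extend F t p)) p
          (FiberBundle.extend F w p)) y v
      = T.metric.inner y (T.nabla (fun p => T.nabla (FiberBundle.extend F z) p
            (FiberBundle.extend F w p)) y v) t
        + T.metric.inner y (T.nabla (FiberBundle.extend F z) y w)
            (T.nablaBar (FiberBundle.extend F t) y v)
        + (T.metric.inner y (T.nabla (FiberBundle.extend F z) y v)
            (T.nablaBar (FiberBundle.extend F t) y w)
          + T.metric.inner y z (T.nablaBar (fun p => T.nablaBar (FiberBundle.extend F t) p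
            (FiberBundle.extend F w p)) y v)) := by
    have hA := (T.smoothConnection_nabla.smoothFieldAt_extend z w).self_of_nhds
    have hB := (T.smoothConnection_nablaBar.smoothFieldAt_extend t w).self_of_nhds
    have hz0 := hz.self_of_nhds
    have ht0 := ht.self_of_nhds
    have hev : (fun p => mvfderiv J (fun p =>
        T.metric.inner p (FiberBundle.extend F z p) (FiberBundle.extend F t p)) p
          (FiberBundle.extend F w p)) =ᶠ[nhds y] fun p =>
        T.metric.inner p (T.nabla (FiberBundle.extend F z) p (FiberBundle.extend F w p))
          (FiberBundle.extend F t p)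
        + T.metric.inner p (FiberBundle.extend F z p)
          (T.nablaBar (FiberBundle.extend F t) p (FiberBundle.extend F w p)) := by
      filter_upwards [hz, ht] with p hz ht
      exact conjugate_spec T.metric T.nabla hz.mdifferentiableAt ht.mdifferentiableAt _
    have h1 := conjugate_spec T.metric T.nabla hA.mdifferentiableAt ht0.mdifferentiableAt v
    have h2 := conjugate_spec T.metric T.nabla hz0.mdifferentiableAt hB.mdifferentiableAt v
    simp only [FiberBundle.extend_apply_self] at h1 h2
    rw [hev.mvfderiv_eq, mvfderiv_fun_add
      (mdifferentiableAt_inner T.metric hA.mdifferentiableAt ht0.mdifferentiableAt)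
      (mdifferentiableAt_inner T.metric hz0.mdifferentiableAt hB.mdifferentiableAt), add_apply,
      h1, h2]
    rfl
  have h := mvfderiv_mvfderiv_extend hf v w
  rw [key, key] at h
  rw [curvature_eq, curvature_eq, metric_sub_left, map_sub]
  linear_combination h

end StatGeom.StatisticalStructure

end Curvature

/-! ### Traces and orthonormal bases -/

theorem IsBilinearMap.eq_sum_basis {V W ι : Type*} [AddCommGroup V] [Module ℝ V]
    [AddCommGroup W] [Module ℝ W] [Fintype ι] {B : V → V → W} (hB : IsBilinearMap ℝ B)
    (f : Module.Basis ι ℝ V) (v w : V) :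
    B v w = ∑ i, ∑ j, (f.repr v i * f.repr w j) • B (f i) (f j) := by
  conv_lhs => rw [← f.sum_repr v, ← f.sum_repr w]
  change hB.toLinearMap _ _ = _
  simp only [map_sum, map_smul, LinearMap.sum_apply, LinearMap.smul_apply, Finset.smul_sum,
    smul_smul]
  rw [Finset.sum_comm]
  simp only [mul_comm]
  rfl

/-- The trace of a bilinear map does not depend on the orthonormal basis. -/
theorem IsBilinearMap.sum_eq_sum_of_orthonormal {V W ι κ : Type*} [AddCommGroup V] [Module ℝ V]
    [AddCommGroup W] [Module ℝ W] [Fintype ι] [Fintype κ] [DecidableEq ι] [DecidableEq κ]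
    {g : V → V → ℝ} (hg : IsBilinearMap ℝ g) {B : V → V → W} (hB : IsBilinearMap ℝ B)
    (f : Module.Basis ι ℝ V) (hf : ∀ i j, g (f i) (f j) = if i = j then 1 else 0)
    {b : κ → V} (hb : ∀ i j, g (b i) (b j) = if i = j then 1 else 0)
    (hcard : Fintype.card κ = Fintype.card ι) : ∑ k, B (b k) (b k) = ∑ i, B (f i) (f i) := by
  let A : Matrix κ ι ℝ := Matrix.of fun k i => f.repr (b k) i
  have hA : A * A.transpose = 1 := by
    ext k l
    rw [Matrix.one_apply, ← hb k l, hg.eq_sum_basis f]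
    simp [Matrix.mul_apply, hf, A]
  -- Equal cardinalities make `A` square, so its right inverse is also a left inverse; `b` need not
  -- be known to span.
  have hA' : A.transpose * A = 1 := (Matrix.mul_eq_one_comm_of_card_eq _ _ _ hcard).1 hA
  calc ∑ k, B (b k) (b k)
      = ∑ k, ∑ i, ∑ j, (A k i * A k j) • B (f i) (f j) :=
        Finset.sum_congr rfl fun k _ => hB.eq_sum_basis f _ _
    _ = ∑ i, ∑ j, (A.transpose * A) i j • B (f i) (f j) := by
        rw [Finset.sum_comm]
        refine Finset.sum_congr rfl fun i _ => ?_
        rw [Finset.sum_comm]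
        simp [Matrix.mul_apply, Finset.sum_smul]
    _ = ∑ i, B (f i) (f i) := by
        simp [hA', Matrix.one_apply]

/-! ### Geometry of a statistical hypersurface -/

section Hypersurface

variable {E : Type*} [NormedAddCommGroup E] [NormedSpace ℝ E] [FiniteDimensional ℝ E]
  {H : Type*} [TopologicalSpace H] {I : ModelWithCorners ℝ E H}
  {M : Type*} [TopologicalSpace M] [ChartedSpace H M] [IsManifold I ∞ M]
  {F : Type*} [NormedAddCommGroup F] [NormedSpace ℝ F] [FiniteDimensional ℝ F]
  {G : Type*} [TopologicalSpace G] {J : ModelWithCorners ℝ F G}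
  {N : Type*} [TopologicalSpace N] [ChartedSpace G N] [IsManifold J ∞ N]

namespace StatGeom.StatisticalStructure

variable {S : StatisticalStructure I M} {T : StatisticalStructure J N} {u : M → N}

theorem IsInducedBy.inner_tau_mfderiv (hu : S.IsInducedBy T u) (x : M) (w : TangentSpace I x) :
    T.metric.inner (u x) (S.tau T u x) (mfderiv I J u x w) = 0 := by
  rw [tau, tension, metricTrace, metric_sum_left]
  refine Finset.sum_eq_zero fun i _ => ?_
  rw [metric_sub_left, ← hu.nabla_eq _ _ (FiberBundle.mdifferentiableAt_extend ..),
    ← hu.metric_eq, sub_self]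

/-- In codimension one, `ν` and the `u_* e_i` are orthonormal and of the right number, so they
compute the trace. -/
theorem IsInducedBy.metricTrace_eq (hu : S.IsInducedBy T u)
    (hdim : Module.finrank ℝ F = Module.finrank ℝ E + 1) {x : M} {ν : TangentSpace J (u x)}
    (hν : T.metric.inner (u x) ν ν = 1)
    (hνu : ∀ w : TangentSpace I x, T.metric.inner (u x) ν (mfderiv I J u x w) = 0)
    {W : Type*} [AddCommGroup W] [Module ℝ W] {B : TangentSpace J (u x) → TangentSpace J (u x) → W}
    (hB : IsBilinearMap ℝ B) :
    metricTrace T.metric (u x) B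
      = B ν ν + metricTrace S.metric x fun v w => B (mfderiv I J u x v) (mfderiv I J u x w) := by
  let b : Option (Fin (Module.finrank ℝ E)) → TangentSpace J (u x) := fun o =>
    o.elim ν fun i => mfderiv I J u x (frame S.metric x i)
  have hb : ∀ i j, T.metric.inner (u x) (b i) (b j) = if i = j then 1 else 0 := by
    rintro (_ | i) (_ | j)
    · simpa [b] using hν
    · simpa [b] using hνu _
    · simpa [b, T.metric.symm (u x) _ ν] using hνu _
    · simpa [b, hu.metric_eq] using inner_frame S.metric x i j
  have h := (isBilinearMap_inner T.metric (u x)).sum_eq_sum_of_orthonormal hB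
    (frame T.metric (u x)) (inner_frame T.metric (u x)) hb (by simp [hdim])
  rw [Fintype.sum_option] at h
  exact h.symm

/-- By `StatisticalStructure.inner_K` the tensor `K` is determined by `∇g`, and `∇g` on `M` is the
pullback of its counterpart on `N`. -/
theorem IsInducedBy.inner_K (hu : S.IsInducedBy T u) (x : M) (v w z : TangentSpace I x) :
    S.metric.inner x (S.K x v w) z = T.metric.inner (u x)
      (T.K (u x) (mfderiv I J u x v) (mfderiv I J u x w)) (mfderiv I J u x z) := by
  have hw := (eventually_smoothFieldAt_extend w).self_of_nhds
  have hz := (eventually_smoothFieldAt_extend z).self_of_nhds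
  have h1 := nablaMetric_apply S.metric S.nabla hw.mdifferentiableAt hz.mdifferentiableAt v
  have h2 := mvfderiv_inner_along T.metric T.nabla
    (smoothAlongAt_pushforward hu.contMDiff.contMDiffAt hw)
    (smoothAlongAt_pushforward hu.contMDiff.contMDiffAt hz) v
  have h3 : (fun y => T.metric.inner (u y) (pushforward I J u (FiberBundle.extend E w) y)
      (pushforward I J u (FiberBundle.extend E z) y))
      = fun y => S.metric.inner y (FiberBundle.extend E w y) (FiberBundle.extend E z y) :=
    funext fun y => (hu.metric_eq y _ _).symm
  have h4 := hu.nabla_eq _ x hw.mdifferentiableAt v z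
  have h5 := hu.nabla_eq _ x hz.mdifferentiableAt v w
  rw [h3] at h2
  rw [S.metric.symm] at h5
  rw [T.metric.symm] at h5
  simp only [pushforward, FiberBundle.extend_apply_self] at h1 h2
  rw [StatisticalStructure.inner_K, StatisticalStructure.inner_K, h1, h2, h4, h5]
  ring

theorem IsInducedBy.traceK_eq_zero (hu : S.IsInducedBy T u)
    (hdim : Module.finrank ℝ F = Module.finrank ℝ E + 1) {x : M} {ν : TangentSpace J (u x)}
    (hν : T.metric.inner (u x) ν ν = 1)
    (hνu : ∀ w : TangentSpace I x, T.metric.inner (u x) ν (mfderiv I J u x w) = 0)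
    (hK : T.K (u x) ν ν = 0) (htrace : T.traceK (u x) = 0) : S.traceK x = 0 := by
  have h := hu.metricTrace_eq hdim hν hνu (T.isBilinearMap_K (u x))
  rw [hK, zero_add] at h
  refine eq_of_inner S.metric fun z => ?_
  rw [traceK, metricTrace, metric_sum_left, Finset.sum_congr rfl fun i _ => hu.inner_K x _ _ z,
    ← metric_sum_left]
  have h' : ∑ i, T.K (u x) (mfderiv I J u x (frame S.metric x i))
      (mfderiv I J u x (frame S.metric x i)) = 0 := h.symm.trans htrace
  rw [h']
  simp

end StatGeom.StatisticalStructure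

end Hypersurface

/-! ### Ricci tensors and the tensor `L` -/

section Ricci

variable {F : Type*} [NormedAddCommGroup F] [NormedSpace ℝ F] [FiniteDimensional ℝ F]
  {G : Type*} [TopologicalSpace G] {J : ModelWithCorners ℝ F G}
  {N : Type*} [TopologicalSpace N] [ChartedSpace G N] [IsManifold J ∞ N]

theorem isBilinearMap_inner_curvature (g : Metric J N) {D : AffineConnection J N}
    (hD : SmoothConnection D) (y : N) (w z : TangentSpace J y) :
    IsBilinearMap ℝ fun v v' : TangentSpace J y => g.inner y (curvature D y v w z) v' := by
  have h := isLinearMap_curvature hD y w z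
  refine ⟨fun a b v => ?_, fun c a v => ?_, fun v a b => map_add _ _ _, fun c v a => map_smul _ _ _⟩
  · rw [h.map_add, metric_add_left]
  · rw [h.map_smul, metric_smul_left, smul_eq_mul]

namespace StatGeom.StatisticalStructure

variable [T2Space N] (T : StatisticalStructure J N)

/-- Trace of `curvature_add_curvature_nablaBar`: of the commutator of `K`, the part through `K(v,
v)` vanishes and self-adjointness turns the other into a sum of squares. -/
theorem ricci_add_ricci_nablaBar {y : N} {v : TangentSpace J y} (hv : T.K y v v = 0) :
    ricci T.metric T.nabla y v v + ricci T.metric T.nablaBar y v v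
      = 2 * (ricci T.metric T.leviCivita y v v
        - metricTrace T.metric y fun a b => T.metric.inner y (T.K y v a) (T.K y v b)) := by
  have hB := T.isBilinearMap_K y
  simp only [ricci, metricTrace]
  rw [← Finset.sum_add_distrib, ← Finset.sum_sub_distrib, Finset.mul_sum]
  refine Finset.sum_congr rfl fun i _ => ?_
  rw [← metric_add_left, T.curvature_add_curvature_nablaBar, metric_smul_left, metric_add_left,
    metric_sub_left, hv, T.K_symm y _ v, T.inner_K_comm y v]
  have h0 : T.K y (frame T.metric y i) 0 = 0 := by
    simpa using hB.smul_right (0 : ℝ) (frame T.metric y i) 0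
  rw [h0, map_zero, zero_apply, zero_sub]
  ring

theorem inner_L (y : N) (z w a b : TangentSpace J y) :
    T.metric.inner y (T.L y z w a) b = T.metric.inner y (curvature T.nabla y a b z) w := by
  have h := isLinearMap_curvature T.smoothConnection_nabla y a z
  let φ : TangentSpace J y →ₗ[ℝ] ℝ :=
    { toFun := fun b => T.metric.inner y (curvature T.nabla y a b z) w
      -- Linearity in the second slot is drawn from the first by antisymmetry.
      map_add' := fun b c => by
        rw [curvature_swap, h.map_add, neg_add, metric_add_left, ← curvature_swap,
          ← curvature_swap]
      map_smul' := fun c b => by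
        rw [curvature_swap, h.map_smul, ← smul_neg, metric_smul_left, ← curvature_swap]
        rfl }
  exact inner_sharp T.metric y φ b

end StatGeom.StatisticalStructure

end Ricci

/-! ### Fields of constant norm with `K(σ, σ) = 0` -/

section ConstantNorm

variable {E : Type*} [NormedAddCommGroup E] [NormedSpace ℝ E] [FiniteDimensional ℝ E]
  {H : Type*} [TopologicalSpace H] {I : ModelWithCorners ℝ E H}
  {M : Type*} [TopologicalSpace M] [ChartedSpace H M] [IsManifold I ∞ M]
  {F : Type*} [NormedAddCommGroup F] [NormedSpace ℝ F] [FiniteDimensional ℝ F]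
  {G : Type*} [TopologicalSpace G] {J : ModelWithCorners ℝ F G}
  {N : Type*} [TopologicalSpace N] [ChartedSpace G N] [IsManifold J ∞ N]

namespace StatGeom.StatisticalStructure

variable [T2Space N] (T : StatisticalStructure J N) {u : M → N} {σ : Π x : M, TangentSpace J (u x)}

/-- Constancy of the norm makes `h(∇̄_v σ, σ) + h(σ, ∇_v σ)` vanish. The two summands differ by a
multiple of `h(K(u_* v, σ), σ) = h(u_* v, K(σ, σ)) = 0`, so each is zero. -/
theorem inner_pullback_nablaBar_self {c : ℝ} (hσ : ∀ x, SmoothAlongAt I u σ x)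
    (hK : ∀ x, T.K (u x) (σ x) (σ x) = 0) (hc : ∀ x, T.metric.inner (u x) (σ x) (σ x) = c)
    (x : M) (v : TangentSpace I x) :
    T.metric.inner (u x) (pullback T.nablaBar u σ x v) (σ x) = 0 := by
  have h := mvfderiv_inner_conjugate T (hσ x) (hσ x) v
  have hconst : (fun y => T.metric.inner (u y) (σ y) (σ y)) = fun _ => c := funext hc
  have hk : T.metric.inner (u x) (T.K (u x) (mfderiv I J u x v) (σ x)) (σ x) = 0 := by
    rw [T.K_symm, T.inner_K_comm, hK, map_zero]
  have h1 := pullback_nabla T σ x v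
  have h2 := pullback_nablaBar T σ x v
  rw [hconst, mvfderiv_const, zero_apply, T.metric.symm (u x) (σ x), h1, h2, metric_sub_left,
    metric_add_left, hk] at h
  rw [h2, metric_sub_left, hk]
  linarith

/-- `h(∇̄_v σ, σ)` vanishes identically: this removes the first-order term of the Laplacian, and
differentiating the identity moves one derivative onto the other factor, pointwise and without
integration. -/
theorem inner_laplacian_self [T2Space M] (S : StatisticalStructure I M) {c : ℝ}
    (hσ : ∀ x, SmoothAlongAt I u σ x)
    (hK : ∀ x, T.K (u x) (σ x) (σ x) = 0) (hc : ∀ x, T.metric.inner (u x) (σ x) (σ x) = c)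
    (x : M) :
    T.metric.inner (u x) (laplacian S.metric S.nablaBar T.nablaBar u σ x) (σ x)
      = - metricTrace S.metric x fun v w => T.metric.inner (u x)
        (pullback T.nablaBar u σ x v) (pullback T.nabla u σ x w) := by
  have hbar := T.inner_pullback_nablaBar_self hσ hK hc
  rw [laplacian, metricTrace, metricTrace, metric_sum_left, ← Finset.sum_neg_distrib]
  refine Finset.sum_congr rfl fun i _ => ?_
  set v := frame S.metric x i
  have hs := SmoothAlongAt.pullback T.smoothConnection_nablaBar
    (Filter.Eventually.of_forall hσ) (eventually_smoothFieldAt_extend v).self_of_nhds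
  have h := mvfderiv_inner_conjugate T hs (hσ x) v
  have h0 : (fun y => T.metric.inner (u y)
      (pullback T.nablaBar u σ y (FiberBundle.extend E v y)) (σ y)) = fun _ => (0 : ℝ) :=
    funext fun y => hbar y _
  rw [h0, mvfderiv_const, zero_apply, FiberBundle.extend_apply_self] at h
  rw [metric_sub_left, hbar, sub_zero]
  linarith

end StatGeom.StatisticalStructure

end ConstantNorm

/-! ### The biharmonic equation paired with the tension field -/

section Biharmonic

variable {E : Type*} [NormedAddCommGroup E] [NormedSpace ℝ E] [FiniteDimensional ℝ E]
  {H : Type*} [TopologicalSpace H] {I : ModelWithCorners ℝ E H}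
  {M : Type*} [TopologicalSpace M] [T2Space M] [ChartedSpace H M] [IsManifold I ∞ M]
  {F : Type*} [NormedAddCommGroup F] [NormedSpace ℝ F] [FiniteDimensional ℝ F]
  {G : Type*} [TopologicalSpace G] {J : ModelWithCorners ℝ F G}
  {N : Type*} [TopologicalSpace N] [T2Space N] [ChartedSpace G N] [IsManifold J ∞ N]

namespace StatGeom.StatisticalStructure

variable {S : StatisticalStructure I M} {T : StatisticalStructure J N} {u : M → N}

theorem metric_self_nonneg (T : StatisticalStructure J N) (y : N) (v : TangentSpace J y) :
    0 ≤ T.metric.inner y v v := by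
  by_cases hv : v = 0
  · simp [hv]
  · exact (T.metric.pos y v hv).le

theorem IsInducedBy.smoothAlongAt_tau (hu : S.IsInducedBy T u) (x : M) :
    SmoothAlongAt I u (S.tau T u) x :=
  smoothAlongAt_tension S.metric S.smoothConnection_nabla T.smoothConnection_nabla hu.contMDiff x

/-- If the tension field is parallel at `x` for the Levi-Civita connection, its square norm is its
inner product with `∑ K(u_* e_i, u_* e_i)`. -/
theorem IsInducedBy.inner_tau_self_eq (hu : S.IsInducedBy T u) (x : M)
    (hpar : ∀ i, pullback T.leviCivita u (S.tau T u) x (frame S.metric x i) = 0) :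
    T.metric.inner (u x) (S.tau T u x) (S.tau T u x)
      = T.metric.inner (u x) (S.tau T u x) (metricTrace S.metric x fun v w =>
        T.K (u x) (mfderiv I J u x v) (mfderiv I J u x w)) := by
  have hN := hu.inner_tau_mfderiv x
  conv_lhs =>
    enter [2]
    rw [tau, tension, metricTrace]
  rw [metricTrace, map_sum, map_sum]
  refine Finset.sum_congr rfl fun i _ => ?_
  set v := frame S.metric x i with hv
  -- Differentiate `h(τ, u_* v) = 0`. Since `τ` is parallel, `∇̄_v τ = -K(u_* v, τ)`, and
  -- self-adjointness of `K` moves `τ` out.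
  have hs := (eventually_smoothFieldAt_extend v).self_of_nhds
  have h := mvfderiv_inner_conjugate T (hu.smoothAlongAt_tau x)
    (smoothAlongAt_pushforward hu.contMDiff.contMDiffAt hs) v
  have h0 : (fun y => T.metric.inner (u y) (S.tau T u y)
      (pushforward I J u (FiberBundle.extend E v) y)) = fun _ => (0 : ℝ) :=
    funext fun y => hu.inner_tau_mfderiv y _
  rw [h0, mvfderiv_const, zero_apply, pullback_nablaBar, hpar, zero_sub, map_neg, neg_apply] at h
  rw [map_sub, hN, sub_zero]
  simp only [pushforward, FiberBundle.extend_apply_self] at h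
  rw [T.inner_K_comm] at h
  linarith

theorem IsInducedBy.tau_eq_zero_of_isBiharmonic [J.Boundaryless] (hu : S.IsInducedBy T u)
    (hdim : Module.finrank ℝ F = Module.finrank ℝ E + 1) (htrace : T.TraceFree)
    (hric : ∀ (y : N) (v : TangentSpace J y),
      0 ≤ ricci T.metric T.nabla y v v - ricci T.metric T.nablaBar y v v
        - 2 * ricci T.metric T.leviCivita y v v)
    (hbi : S.IsBiharmonic T u)
    (hK : ∀ x : M, T.K (u x) (S.tau T u x) (S.tau T u x) = 0)
    {c : ℝ} (hc : ∀ x : M, T.metric.inner (u x) (S.tau T u x) (S.tau T u x) = c) (x : M) :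
    S.tau T u x = 0 := by
  by_contra hτ0
  have hcpos : 0 < c := by
    rw [← hc x]
    exact T.metric.pos _ _ hτ0
  have hunit (y : M) : ∃ a : ℝ, T.metric.inner (u y) (a • S.tau T u y) (a • S.tau T u y) = 1 := by
    refine ⟨(√c)⁻¹, ?_⟩
    rw [metric_smul_left, map_smul, hc, smul_eq_mul, ← mul_assoc, ← mul_inv,
      Real.mul_self_sqrt hcpos.le, inv_mul_cancel₀ hcpos.ne']
  have hnormal (y : M) (a : ℝ) (w : TangentSpace I y) :
      T.metric.inner (u y) (a • S.tau T u y) (mfderiv I J u y w) = 0 := by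
    rw [metric_smul_left, hu.inner_tau_mfderiv, mul_zero]
  have hKa (y : M) (a : ℝ) : T.K (u y) (a • S.tau T u y) (a • S.tau T u y) = 0 := by
    rw [(T.isBilinearMap_K (u y)).smul_left, (T.isBilinearMap_K (u y)).smul_right, hK, smul_zero,
      smul_zero]
  have htraceK : S.traceK = 0 := by
    funext y
    obtain ⟨a, ha⟩ := hunit y
    exact hu.traceK_eq_zero hdim ha (hnormal y a) (hKa y a) (htrace (u y))
  obtain ⟨a, ha⟩ := hunit x
  set τ := S.tau T u x with hτ
  -- The normal direction does not contribute to `Ric̄(τ, τ)`, because it is a multiple of `τ` and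
  -- `R̄(τ, τ) = 0`.
  have hric_bar : ricci T.metric T.nablaBar (u x) τ τ = metricTrace S.metric x fun v w =>
      T.metric.inner (u x) (curvature T.nablaBar (u x) (mfderiv I J u x v) τ τ)
        (mfderiv I J u x w) := by
    have hlin := isLinearMap_curvature T.smoothConnection_nablaBar (u x) τ τ
    rw [ricci, hu.metricTrace_eq hdim ha (hnormal x a)
      (isBilinearMap_inner_curvature T.metric T.smoothConnection_nablaBar (u x) τ τ),
      hlin.map_smul, curvature_self, smul_zero, map_zero, zero_apply, zero_add]
  have hKK : metricTrace T.metric (u x) (fun v w => T.metric.inner (u x)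
      (T.K (u x) τ v) (T.K (u x) τ w)) = metricTrace S.metric x fun v w => T.metric.inner (u x)
        (T.K (u x) τ (mfderiv I J u x v)) (T.K (u x) τ (mfderiv I J u x w)) := by
    have hB := T.isBilinearMap_K (u x)
    have hG := isBilinearMap_inner T.metric (u x)
    have hbil : IsBilinearMap ℝ fun v w : TangentSpace J (u x) => T.metric.inner (u x)
        (T.K (u x) τ v) (T.K (u x) τ w) :=
      ⟨fun _ _ _ => by rw [hB.add_right, hG.add_left],
        fun _ _ _ => by rw [hB.smul_right, hG.smul_left],
        fun _ _ _ => by rw [hB.add_right, hG.add_right],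
        fun _ _ _ => by rw [hB.smul_right, hG.smul_right]⟩
    rw [hu.metricTrace_eq hdim ha (hnormal x a) hbil, hB.smul_right, hK, smul_zero, map_zero, zero_add]
  have hle := hric (u x) τ
  have hsum := T.ricci_add_ricci_nablaBar (hK x)
  rw [← hτ, hKK] at hsum
  have hbix : T.metric.inner (u x) (S.bitension T u x) τ = 0 := by
    rw [hbi x, map_zero, zero_apply]
  have hdiv : divergence S.leviCivita S.traceK x = 0 := by
    rw [divergence, htraceK, S.leviCivita.zero]
    exact map_zero _
  rw [bitension, ← hτ, hK x, hdiv, zero_smul, add_zero, sub_zero, metric_sub_left,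
    T.inner_laplacian_self S hu.smoothAlongAt_tau hK hc] at hbix
  -- `h(L(e_i, τ) e_i, τ) = h(R(e_i, τ) e_i, τ) = -h(e_i, R̄(e_i, τ) τ)`.
  have hL : T.metric.inner (u x) (metricTrace S.metric x fun v w =>
      T.L (u x) (mfderiv I J u x v) τ (mfderiv I J u x w)) τ
        = - ricci T.metric T.nablaBar (u x) τ τ := by
    rw [hric_bar, metricTrace, metricTrace, metric_sum_left, ← Finset.sum_neg_distrib]
    refine Finset.sum_congr rfl fun i _ => ?_
    rw [T.inner_L, T.inner_curvature_nabla, T.metric.symm]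
  rw [hL] at hbix
  have hsplit : (metricTrace S.metric x fun v w => T.metric.inner (u x)
        (pullback T.nablaBar u (S.tau T u) x v) (pullback T.nabla u (S.tau T u) x w))
      = (metricTrace S.metric x fun v w => T.metric.inner (u x)
        (pullback T.leviCivita u (S.tau T u) x v) (pullback T.leviCivita u (S.tau T u) x w))
        - metricTrace S.metric x fun v w => T.metric.inner (u x)
        (T.K (u x) τ (mfderiv I J u x v)) (T.K (u x) τ (mfderiv I J u x w)) := by
    simp only [metricTrace]
    rw [← Finset.sum_sub_distrib]
    refine Finset.sum_congr rfl fun i _ => ?_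
    rw [pullback_nablaBar, pullback_nabla, metric_sub_left, map_add, map_add, T.K_symm _ τ,
      T.metric.symm _ (T.K _ _ _) (pullback _ _ _ _ _)]
    ring
  rw [hsplit] at hbix
  have hzero : (∑ i, T.metric.inner (u x)
      (pullback T.leviCivita u (S.tau T u) x (frame S.metric x i))
      (pullback T.leviCivita u (S.tau T u) x (frame S.metric x i))) = 0 := by
    refine le_antisymm ?_ (Finset.sum_nonneg fun i _ => metric_self_nonneg T _ _)
    change (metricTrace S.metric x fun v w => T.metric.inner (u x)
        (pullback T.leviCivita u (S.tau T u) x v) (pullback T.leviCivita u (S.tau T u) x w)) ≤ 0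
    -- With `A` this sum and `B` the sum of `|K(τ, e_i)|²`: `hbix` says `A = B + Ric̄`, `hsum`
    -- expresses `B` through the Ricci tensors, and `hle` bounds the result by zero.
    linarith
  have hpar (i) : pullback T.leviCivita u (S.tau T u) x (frame S.metric x i) = 0 := by
    by_contra hne
    exact (T.metric.pos _ _ hne).ne'
      ((Finset.sum_eq_zero_iff_of_nonneg fun i _ => metric_self_nonneg T _ _).1 hzero i
        (Finset.mem_univ i))
  -- As `K(ν, ν) = 0`, the tangential trace of `K` is its full trace, hence zero by `htrace`.
  have hKtr := hu.metricTrace_eq hdim ha (hnormal x a) (T.isBilinearMap_K (u x))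
  rw [hKa, zero_add] at hKtr
  have hend := hu.inner_tau_self_eq x hpar
  rw [hc, ← hKtr] at hend
  refine hcpos.ne' (hend.trans ?_)
  have : metricTrace T.metric (u x) (T.K (u x)) = 0 := htrace (u x)
  rw [this, map_zero]

end StatGeom.StatisticalStructure

end Biharmonic

end

/-! ### The proposition -/

theorem mainTheorem6 {m : ℕ}
    {M : Type*} [TopologicalSpace M] [T2Space M]
    [ChartedSpace (EuclideanSpace ℝ (Fin m)) M] [IsManifold (𝓡 m) ∞ M]
    {N : Type*} [TopologicalSpace N] [T2Space N]
    [ChartedSpace (EuclideanSpace ℝ (Fin (m + 1))) N] [IsManifold (𝓡 (m + 1)) ∞ N]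
    (S : StatisticalStructure (𝓡 m) M) (T : StatisticalStructure (𝓡 (m + 1)) N)
    (u : M → N)
    (hu : S.IsInducedBy T u)
    (htrace : T.TraceFree)
    (hric : ∀ (y : N) (v : TangentSpace (𝓡 (m + 1)) y),
      0 ≤ ricci T.metric T.nabla y v v - ricci T.metric T.nablaBar y v v
        - 2 * ricci T.metric T.leviCivita y v v)
    (hbi : S.IsBiharmonic T u)
    (hK : ∀ x : M, T.K (u x) (S.tau T u x) (S.tau T u x) = 0)
    (hnorm : ∃ c : ℝ, ∀ x : M, √(T.metric.inner (u x) (S.tau T u x) (S.tau T u x)) = c) :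
    ∀ x : M, S.tau T u x = 0 := by
  obtain ⟨c, hc⟩ := hnorm
  -- The constant so far is the squared norm, hence `c ^ 2`.
  refine hu.tau_eq_zero_of_isBiharmonic (by simp) htrace hric hbi hK (c := c ^ 2) fun x => ?_
  rw [← hc x, Real.sq_sqrt (StatisticalStructure.metric_self_nonneg T _ _)]
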